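/- Let $n\ge 0$, let $w^\mu=(w^0,w^i)$, $i=1,\dots,n$, be the standard coordinates on $\mathbb R^{n+1}$, $\underline{\eta}=\mathrm{diag}(-1,1,\dots,1)$, $\vec w=(w^i)$, $r=|\vec w|$ (Euclidean norm), $\Theta^i=w^i/r$, and let $C_O=\{w^0=r\}$ be the light cone, parameterized by $\vec w\in\mathbb R^n$. Let $\mathring s$ be the round unit metric on $S^{n-1}$, pulled back to $C_O\setminus\{O\}$ by $\vec w\mapsto\Theta$. In spherical coordinates $(r,x^A)$ on $C_O$, a tensor field $\varphi=\varphi_{AB}\,dx^A dx^B$ on $C_O\setminus\{O\}$ is a field of bilinear forms that vanishes when one argument is radial; its components in the coordinates $w^i$ are $\varphi_{AB}\frac{\partial x^A}{\partial w^p}\frac{\partial x^B}{\partial w^q}$. For $R\in(0,\infty]$, a function on $\{0\le r<R\}\subset C_O$ is called $C_O$-smooth if it is of the form $\hat f+r\check f$ with $\hat f,\check f$ smooth functions of $\vec w$ on $\{|\vec w|<R\}$. For $R\in(0,\infty]$ consider the following two conditions on $\varphi$. (a)$_R$ There are an open set $U\subset\mathbb R^{n+1}$, star-shaped about the origin and containing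 $\{0\le r<R\}\subset C_O$, and a smooth Lorentzian metric $g$ on $U$ for which the $w^\mu$ are normal coordinates centred at the origin (that is, $g_{\mu\nu}(0)=\underline{\eta}_{\mu\nu}$ and the rays $t\mapsto ta$ are affinely parameterized geodesics), such that on $\{0<r<R\}$ the pull-back of $g$ to $C_O$ equals $\varphi$. (b)$_R$ There exist functions $A_{ij}$, $A_{ijk}$, $A_{ijkl}$, $C_O$-smooth on $\{0\le r<R\}$, with $$A_{ij}=A_{ji},\qquad A_{ijk}=-A_{ikj},\qquad A_{ijkl}=A_{klij}=-A_{jikl},$$ such that on $\{0<r<R\}$, for all $p,q$ (repeated indices being summed from $1$ to $n$), $$\begin{aligned} (\varphi_{AB}-r^2\mathring s_{AB})\frac{\partial x^A}{\partial w^p}\frac{\partial x^B}{\partial w^q} ={}&A_{ij}w^iw^j\Theta^p\Theta^q+w^k\big(A_{iqk}w^i\Theta^p+A_{jpk}w^j\Theta^q\big)\\ &+r^2A_{pq}-A_{iq}w^iw^p-A_{pi}w^iw^q-\big(rA_{pqk}+rA_{qpk}-A_{pkql}w^l\big)w^k . \end{aligned}$$ Then: 1. $\varphi$ is, near the vertex,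 the restriction to the light cone of a metric in normal coordinates if and only if it has the above form near the vertex: (a)$_R$ holds for some $R>0$ if and only if (b)$_R$ holds for some $R>0$. 2. For each given $R\in(0,\infty]$: (a)$_R$ holds if and only if (b)$_R$ holds and $(\varphi_{AB})$ is positive definite at all points with $0<r<R$. -/

import Mathlib

open scoped ContDiff

noncomputable section

namespace LightCone

/-- The space `ℝⁿ` of the `w⃗ = (wⁱ)`, with its Euclidean norm `r = |w⃗|`. It coordinatises the
light cone `C_O = {w⁰ = |w⃗|}` in `ℝⁿ⁺¹`. -/
abbrev Space (n : ℕ) : Type := EuclideanSpace ℝ (Fin n)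

/-- Space-time `ℝⁿ⁺¹` with the coordinates `w⁰, …, wⁿ`; the index `0` is the time index. -/
abbrev Spacetime (n : ℕ) : Type := Fin (n + 1) → ℝ

/-- The part `0 ≤ r < R` of the cone, in the coordinates `w⃗`; here `R ∈ [0, ∞]`. -/
def ballR (n : ℕ) (R : ENNReal) : Set (Space n) := Metric.eball (0 : Space n) R

/-- The parametrisation `w⃗ ↦ (|w⃗|, w⃗)` of the light cone `C_O`. -/
def coneMap (n : ℕ) (w : Space n) : Spacetime n := Fin.cases ‖w‖ (fun i => w i)

/-- The radial projection `Θ(w⃗) = w⃗ / r` onto the unit sphere. -/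
def theta {n : ℕ} (w : Space n) : Space n := ‖w‖⁻¹ • w

/-- The coordinate vector `∂/∂wᵖ` of `ℝⁿ`. -/
def basisVec {n : ℕ} (p : Fin n) : Space n := EuclideanSpace.single p (1 : ℝ)

/-- The round unit metric `s̊ = s̊_{AB} dx^A dx^B` of the sphere, as a tensor on the cone without its
vertex: the pull-back of the Euclidean metric by `Θ`. -/
def roundMetric {n : ℕ} (w X Y : Space n) : ℝ :=
  inner ℝ (fderiv ℝ (theta (n := n)) w X) (fderiv ℝ (theta (n := n)) w Y)

/-- `φ` is a tensor field of the form `φ_{AB} dx^A dx^B` on the cone, where `(r, x^A)` are spherical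
coordinates: a field of bilinear forms (`φ w` is the one at the point with coordinates
`w⃗`) which vanishes as soon as one argument is radial, `∂_r` being the direction of `w⃗`.
The number `φ w ∂_p ∂_q` is then `φ_{AB} (∂x^A/∂w^p) (∂x^B/∂w^q)`. -/
def IsAngular {n : ℕ} (φ : Space n → LinearMap.BilinForm ℝ (Space n)) : Prop :=
  ∀ w X : Space n, φ w w X = 0 ∧ φ w X w = 0

/-- `(φ_{AB})` is positive definite at all points of the cone with `0 < r < R`. -/
def IsPosDefOn {n : ℕ} (R : ENNReal) (φ : Space n → LinearMap.BilinForm ℝ (Space n)) : Prop :=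
  ∀ w ∈ ballR n R, w ≠ 0 → ∀ X : Space n, inner ℝ w X = 0 → X ≠ 0 → 0 < φ w X X

/-- `C_O`-smoothness on the part `r < R` of the cone: `f = f̂ + r f̌` with `f̂`, `f̌` smooth functions
of `w⃗`. -/
def COSmoothOn {n : ℕ} (R : ENNReal) (f : Space n → ℝ) : Prop :=
  ∃ f₁ f₂ : Space n → ℝ, ContDiffOn ℝ ∞ f₁ (ballR n R) ∧ ContDiffOn ℝ ∞ f₂ (ballR n R) ∧
    ∀ w ∈ ballR n R, f w = f₁ w + ‖w‖ * f₂ w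

/-- The Minkowski metric `diag(-1, 1, …, 1)`. -/
def minkowski (n : ℕ) : Matrix (Fin (n + 1)) (Fin (n + 1)) ℝ :=
  Matrix.diagonal (Fin.cases (-1) (fun _ => 1))

/-- The value `G(X, Y) = G_{μν} X^μ Y^ν`. -/
def form {n : ℕ} (G : Matrix (Fin (n + 1)) (Fin (n + 1)) ℝ) (X Y : Spacetime n) : ℝ :=
  ∑ μ, ∑ ν, G μ ν * X μ * Y ν

/-- `G` is a symmetric form of signature `(-, +, …, +)`: there is a vector on which it is negative,
and it is positive definite on the `G`-orthogonal complement of this vector. -/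
def IsLorentzian {n : ℕ} (G : Matrix (Fin (n + 1)) (Fin (n + 1)) ℝ) : Prop :=
  G.IsSymm ∧ ∃ T : Spacetime n, form G T T < 0 ∧
    ∀ X : Spacetime n, form G T X = 0 → X ≠ 0 → 0 < form G X X

/-- `g = g_{μν} dw^μ dw^ν` is a smooth Lorentzian metric on `U`. -/
def IsMetricOn {n : ℕ} (U : Set (Spacetime n))
    (g : Spacetime n → Matrix (Fin (n + 1)) (Fin (n + 1)) ℝ) : Prop :=
  (∀ μ ν, ContDiffOn ℝ ∞ (fun x => g x μ ν) U) ∧ ∀ x ∈ U, IsLorentzian (g x)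

/-- The partial derivative `∂f/∂w^μ`. -/
def partialDeriv {n : ℕ} (μ : Fin (n + 1)) (f : Spacetime n → ℝ) (x : Spacetime n) : ℝ :=
  fderiv ℝ f x (Pi.single μ 1)

/-- The Christoffel symbols `Γ^μ_{αβ}` of `g`. -/
def christoffel {n : ℕ} (g : Spacetime n → Matrix (Fin (n + 1)) (Fin (n + 1)) ℝ)
    (μ α β : Fin (n + 1)) (x : Spacetime n) : ℝ :=
  (1 / 2) * ∑ ν, (g x)⁻¹ μ ν *
    (partialDeriv α (fun y => g y ν β) x + partialDeriv β (fun y => g y ν α) x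
      - partialDeriv ν (fun y => g y α β) x)

/-- The coordinates `w^μ` are normal coordinates, centred at the origin, for the metric `g` on `U`:
`g` is the Minkowski metric at the origin, and the rays `t ↦ t a` satisfy the equation of
affinely parametrised geodesics, `Γ^μ_{αβ}(t a) a^α a^β = 0`. -/
def IsNormalOn {n : ℕ} (U : Set (Spacetime n))
    (g : Spacetime n → Matrix (Fin (n + 1)) (Fin (n + 1)) ℝ) : Prop :=
  g 0 = minkowski n ∧ ∀ (a : Spacetime n) (t : ℝ), t • a ∈ U →
    ∀ μ, ∑ α, ∑ β, christoffel g μ α β (t • a) * a α * a β = 0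

/-- On the part `0 < r < R` of the cone, `φ` is the restriction to `C_O` (that is, the pull-back by
the parametrisation of `C_O`) of a smooth Lorentzian metric in normal coordinates, defined on an
open set which is star-shaped about the origin and contains the part `r < R` of `C_O`. -/
def IsConeRestriction {n : ℕ} (R : ENNReal)
    (φ : Space n → LinearMap.BilinForm ℝ (Space n)) : Prop :=
  ∃ (U : Set (Spacetime n)) (g : Spacetime n → Matrix (Fin (n + 1)) (Fin (n + 1)) ℝ),
    IsOpen U ∧ StarConvex ℝ 0 U ∧ (∀ w ∈ ballR n R, coneMap n w ∈ U) ∧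
    IsMetricOn U g ∧ IsNormalOn U g ∧
    ∀ w ∈ ballR n R, w ≠ 0 → ∀ X Y : Space n,
      φ w X Y = form (g (coneMap n w)) (fderiv ℝ (coneMap n) w X) (fderiv ℝ (coneMap n) w Y)

/-- On the part `0 < r < R` of the cone, the components of `φ - r² s̊` in the coordinates `wⁱ` are
given by the explicit formula, with coefficients `A_{ij}`, `A_{ijk}`, `A_{ijkl}` which are
`C_O`-smooth for `r < R` and have the required symmetries. -/
def HasConeForm {n : ℕ} (R : ENNReal)
    (φ : Space n → LinearMap.BilinForm ℝ (Space n)) : Prop :=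
  ∃ (A : Fin n → Fin n → Space n → ℝ) (B : Fin n → Fin n → Fin n → Space n → ℝ)
    (C : Fin n → Fin n → Fin n → Fin n → Space n → ℝ),
    (∀ i j, COSmoothOn R (A i j)) ∧ (∀ i j k, COSmoothOn R (B i j k)) ∧
    (∀ i j k l, COSmoothOn R (C i j k l)) ∧
    (∀ w ∈ ballR n R, ∀ i j, A i j w = A j i w) ∧
    (∀ w ∈ ballR n R, ∀ i j k, B i j k w = - B i k j w) ∧
    (∀ w ∈ ballR n R, ∀ i j k l, C i j k l w = C k l i j w ∧ C i j k l w = - C j i k l w) ∧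
    ∀ w ∈ ballR n R, w ≠ 0 → ∀ p q : Fin n,
      φ w (basisVec p) (basisVec q) - ‖w‖ ^ 2 * roundMetric w (basisVec p) (basisVec q) =
        (∑ i, ∑ j, A i j w * w i * w j * theta w p * theta w q)
        + (∑ k, w k * ((∑ i, B i q k w * w i * theta w p) + ∑ j, B j p k w * w j * theta w q))
        + ‖w‖ ^ 2 * A p q w
        - (∑ i, A i q w * w i * w p)
        - (∑ i, A p i w * w i * w q)
        - ∑ k, (‖w‖ * B p q k w + ‖w‖ * B q p k w - ∑ l, C p k q l w * w l) * w k

end LightCone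

end

open scoped ContDiff

/-! Given `g 0 = minkowski n`, the coordinates are normal exactly when the Gauss identity g_{μν}x^ν
= η_{μν}x^ν holds (`IsNormalOn.gauss`, `isNormalOn_of_gauss`). Then h = g - η is a symmetric tensor
annihilated by the position vector. On a star-shaped set the radial Poincaré homotopy, applied once
in each index, gives h_{μν} = Ω_{μανβ}x^αx^β, where Ω is smooth and has the pair symmetries of a
curvature tensor (`exists_curvatureForm`). Conversely, these symmetries imply the Gauss identity.

Along the cone dx⁰ = Θ_p dw^p, so η pulls back to r²s̊ and Ω_{μανβ}x^αx^β to the required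
expression, with A_ij = Ω_{0i0j}, A_ijk = Ω_{0ijk}, A_ijkl = Ω_{ijkl}
(`HasCurvatureSymmetries.form_quadraticTensor_coneMap`). Smooth functions on space-time restrict to
`C_O`-smooth ones, by splitting into parts even and odd in x⁰ (`coSmoothOn_comp_coneMap`);
conversely f̂ + x⁰f̌ extends f̂ + rf̌.

There remains the signature. By the Gauss identity the position vector l at a cone point is null and
g(l,·) = η(l,·). A symmetric form with a null vector l outside its radical is Lorentzian if and only
if it is positive definite on l^⊥/l, which here is the space of angular vectors carrying φ_{AB}.
Hence positivity of φ_{AB} is exactly what is needed on the cone; openness of the Lorentzian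
condition gives a neighbourhood, and near the vertex g(0) = η suffices. -/

namespace LightCone

open Set Filter Topology

/-! ### Smooth dependence of integrals on parameters. -/

section ParametricIntegral

variable {E G : Type} [NormedAddCommGroup E] [NormedSpace ℝ E]
  [NormedAddCommGroup G] [NormedSpace ℝ G]

/-- Differentiation under an integral over the unit interval, for a `C¹` integrand. -/
theorem hasFDerivAt_integral_unitInterval {W : Set (ℝ × E)} (hW : IsOpen W) {F : ℝ × E → G}
    (hF : ContDiffOn ℝ 1 F W) {x₀ : E} (hx₀ : ∀ s ∈ Icc (0 : ℝ) 1, (s, x₀) ∈ W) :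
    HasFDerivAt (fun x => ∫ s in (0 : ℝ)..1, F (s, x))
      (∫ s in (0 : ℝ)..1, (fderiv ℝ F (s, x₀)).comp (ContinuousLinearMap.inr ℝ ℝ E)) x₀ := by
  set F' : E → ℝ → E →L[ℝ] G := fun x s =>
    (fderiv ℝ F (s, x)).comp (ContinuousLinearMap.inr ℝ ℝ E) with hF'
  have hcd : ContinuousOn (fun p : ℝ × E => F' p.2 p.1) W :=
    (hF.continuousOn_fderiv_of_isOpen hW le_rfl).clm_comp continuousOn_const
  have hslice : ∀ x : E, (∀ s ∈ Icc (0 : ℝ) 1, (s, x) ∈ W) →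
      ContinuousOn (fun s => F (s, x)) (Icc 0 1) := fun x hx =>
    hF.continuousOn.comp (by fun_prop) hx
  have hslice' : ContinuousOn (fun s => F' x₀ s) (Icc 0 1) :=
    hcd.comp (f := fun s => (s, x₀)) (by fun_prop) hx₀
  obtain ⟨C, hC⟩ := (isCompact_Icc (a := (0 : ℝ)) (b := 1)).bddAbove_image hslice'.norm
  -- Compactness of [0,1] gives one neighbourhood of `x₀` that works for all `s`; the constant `C +
  -- 1` then dominates the derivatives.
  have hev : ∀ᶠ x in 𝓝 x₀, ∀ s ∈ Icc (0 : ℝ) 1, (s, x) ∈ W ∧ ‖F' x s‖ < C + 1 := by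
    refine isCompact_Icc.eventually_forall_of_forall_eventually fun s hs => ?_
    have h1 : ∀ᶠ p : ℝ × E in 𝓝 (s, x₀), p ∈ W ∧ ‖F' p.2 p.1‖ < C + 1 := by
      refine Filter.Eventually.and (hW.mem_nhds (hx₀ s hs)) ?_
      have := (hcd.continuousAt (hW.mem_nhds (hx₀ s hs))).norm
      refine this.eventually_lt continuousAt_const ?_
      have := hC (mem_image_of_mem _ hs)
      simp only at this ⊢
      linarith
    exact (continuous_swap.tendsto (x₀, s)).eventually h1
  have huIoc : ∀ t ∈ Set.uIoc (0 : ℝ) 1, t ∈ Icc (0 : ℝ) 1 := fun t ht => by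
    rw [uIoc_of_le zero_le_one] at ht
    exact Ioc_subset_Icc_self ht
  have hmeas : ∀ {Z : Type} [NormedAddCommGroup Z] (f : ℝ → Z), ContinuousOn f (Icc 0 1) →
      MeasureTheory.AEStronglyMeasurable f
        (MeasureTheory.volume.restrict (Set.uIoc (0 : ℝ) 1)) := by
    intro Z _ f hf
    have := hf.aestronglyMeasurable_of_isCompact isCompact_Icc measurableSet_Icc
      (μ := MeasureTheory.volume)
    exact this.mono_measure (MeasureTheory.Measure.restrict_mono huIoc le_rfl)
  refine intervalIntegral.hasFDerivAt_integral_of_dominated_of_fderiv_le (𝕜 := ℝ)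
    (F := fun x s => F (s, x)) (F' := F') (bound := fun _ => C + 1) hev
    ?_ ?_ ?_ ?_ intervalIntegrable_const ?_
  · filter_upwards [hev] with x hx
    exact hmeas _ (hslice x fun s hs => (hx s hs).1)
  · refine ContinuousOn.intervalIntegrable ?_
    rw [uIcc_of_le zero_le_one]
    exact hslice x₀ hx₀
  · exact hmeas _ hslice'
  · exact Eventually.of_forall fun t ht x hx => (hx t (huIoc t ht)).2.le
  · refine Eventually.of_forall fun t ht x hx => ?_
    have h1 : HasFDerivAt F (fderiv ℝ F (t, x)) (t, x) :=
      ((hF.contDiffAt (hW.mem_nhds (hx t (huIoc t ht)).1)).differentiableAt one_ne_zero).hasFDerivAt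
    exact h1.comp x (hasFDerivAt_prodMk_right t x)

/-- An integral over the unit interval depends smoothly on parameters. -/
theorem contDiffOn_integral_unitInterval {W : Set (ℝ × E)} (hW : IsOpen W) {U : Set E}
    (hU : IsOpen U) (hUW : ∀ x ∈ U, ∀ s ∈ Icc (0 : ℝ) 1, (s, x) ∈ W) {F : ℝ × E → G}
    (hF : ContDiffOn ℝ ∞ F W) :
    ContDiffOn ℝ ∞ (fun x => ∫ s in (0 : ℝ)..1, F (s, x)) U := by
  rw [contDiffOn_infty]
  intro m
  -- The derivative is an integral of the same kind with values in `E →L[ℝ] G`, so the target space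
  -- has to vary.
  induction m generalizing G with
  | zero =>
    refine contDiffOn_zero.2 fun x hx => ?_
    exact (hasFDerivAt_integral_unitInterval hW (hF.of_le (by simp))
      (hUW x hx)).continuousAt.continuousWithinAt
  | succ m ih =>
    have hd := fun x hx => hasFDerivAt_integral_unitInterval hW (hF.of_le (by simp)) (hUW x hx)
    push_cast
    rw [contDiffOn_succ_iff_fderiv_of_isOpen hU]
    refine ⟨fun x hx => (hd x hx).differentiableAt.differentiableWithinAt, by simp, ?_⟩
    refine (ih (F := fun p => (fderiv ℝ F p).comp (ContinuousLinearMap.inr ℝ ℝ E)) ?_).congr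
      fun x hx => (hd x hx).fderiv
    exact (hF.fderiv_of_isOpen hW (by simp)).clm_comp contDiffOn_const

end ParametricIntegral

/-! ### Even and odd functions of t restricted to the cone t = ‖w‖. -/

section EvenOdd

variable {E G : Type} [NormedAddCommGroup E] [InnerProductSpace ℝ E]
  [NormedAddCommGroup G] [NormedSpace ℝ G] [CompleteSpace G]

/-- Hadamard's lemma in one variable: a smooth function which is odd in `t` is `t` times a smooth
function which is even in `t`. -/
theorem exists_even_of_odd {K : ℝ × E → G} (hK : ContDiff ℝ ∞ K)
    (hodd : ∀ t w, K (-t, w) = - K (t, w)) :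
    ∃ H : ℝ × E → G, ContDiff ℝ ∞ H ∧ (∀ t w, H (-t, w) = H (t, w)) ∧
      ∀ t w, K (t, w) = t • H (t, w) := by
  set D : ℝ × E → G := fun p => fderiv ℝ K p (1, 0) with hD
  have hDs : ContDiff ℝ ∞ D := (hK.fderiv_right (by simp)).clm_apply contDiff_const
  have hDd : ∀ t w, HasDerivAt (fun t => K (t, w)) (D (t, w)) t := fun t w => by
    have h1 := (hK.differentiable (by simp) (t, w)).hasFDerivAt
    exact h1.comp_hasDerivAt t ((hasDerivAt_id t).prodMk (hasDerivAt_const t w))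
  have hDe : ∀ t w, D (-t, w) = D (t, w) := fun t w => by
    have h1 : HasDerivAt (fun t => K (-t, w)) (- D (-t, w)) t := by
      simpa [Function.comp_def] using (hDd (-t) w).scomp t (hasDerivAt_neg t)
    have h2 : HasDerivAt (fun t => K (-t, w)) (- D (t, w)) t := by
      simpa only [hodd] using (hDd t w).fun_neg
    simpa using h1.unique h2
  have hK0 : ∀ w, K (0, w) = 0 := fun w => by
    have := hodd 0 w
    rw [neg_zero] at this
    have h2 : (2 : ℝ) • K (0, w) = 0 := by
      rw [two_smul]
      nth_rewrite 1 [this]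
      exact neg_add_cancel _
    simpa using h2
  -- Since K(0,w) = 0, K(t,w) is the integral over s in [0,1] of d/ds K(st,w) = t D(st,w).
  refine ⟨fun p => ∫ s in (0 : ℝ)..1, D (s * p.1, p.2), ?_, fun t w => ?_, fun t w => ?_⟩
  · rw [← contDiffOn_univ]
    refine contDiffOn_integral_unitInterval (F := fun q : ℝ × ℝ × E => D (q.1 * q.2.1, q.2.2))
      isOpen_univ isOpen_univ (by simp) ?_
    rw [contDiffOn_univ]
    exact hDs.comp (by fun_prop)
  · simp only [mul_neg, hDe]
  · have h1 : ∀ s ∈ uIcc (0 : ℝ) 1, HasDerivAt (fun s => K (s * t, w)) (t • D (s * t, w)) s :=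
      fun s _ => HasDerivAt.scomp (h := fun s => s * t) (g₁ := fun t => K (t, w)) s
        (hDd (s * t) w) (by simpa using (hasDerivAt_id s).mul_const t)
    have h2 := intervalIntegral.integral_eq_sub_of_hasDerivAt h1 (by
      refine Continuous.intervalIntegrable ?_ _ _
      exact continuous_const.smul (hDs.continuous.comp (by fun_prop)))
    rw [intervalIntegral.integral_smul] at h2
    simp only [one_mul, zero_mul, hK0, sub_zero] at h2
    exact h2.symm

/-- If `F (t, w)` is smooth and even in `t`, then `F (‖w‖, w)` is a smooth function of `w`. -/
theorem contDiff_comp_norm_of_even {F : ℝ × E → G} (hF : ContDiff ℝ ∞ F)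
    (heven : ∀ t w, F (-t, w) = F (t, w)) : ContDiff ℝ ∞ (fun w => F (‖w‖, w)) := by
  rw [contDiff_infty]
  intro m
  induction m generalizing G with
  | zero => exact contDiff_zero.2 (hF.continuous.comp (by fun_prop))
  | succ m ih =>
    have hFd : ∀ p, HasFDerivAt F (fderiv ℝ F p) p := fun p =>
      (hF.differentiable (by simp) p).hasFDerivAt
    have hfs : ContDiff ℝ ∞ (fderiv ℝ F) := hF.fderiv_right (by simp)
    have hrefl : ∀ p : ℝ × E, fderiv ℝ F (-p.1, p.2) =
        (fderiv ℝ F p).comp ((-ContinuousLinearMap.fst ℝ ℝ E).prod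
          (ContinuousLinearMap.snd ℝ ℝ E)) := by
      intro p
      set S := (-ContinuousLinearMap.fst ℝ ℝ E).prod (ContinuousLinearMap.snd ℝ ℝ E) with hS
      have h1 : HasFDerivAt (F ∘ S) ((fderiv ℝ F (S (-p.1, p.2))).comp S) (-p.1, p.2) :=
        (hFd (S (-p.1, p.2))).comp _ S.hasFDerivAt
      have h2 : F ∘ S = F := by
        funext q
        simp [hS, heven]
      rw [h2] at h1
      rw [h1.fderiv]
      simp [hS]
    obtain ⟨H, hHs, hHe, hH⟩ := exists_even_of_odd (K := fun p => fderiv ℝ F p (1, 0))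
      (hfs.clm_apply contDiff_const) (fun t w => by
        have := hrefl (t, w)
        simp only at this
        rw [this]
        have h3 : ((-1 : ℝ), (0 : E)) = -(1, 0) := by simp
        simp [h3, -Prod.neg_mk])
    -- The chain rule gives ∂_wF + ∂_tF ⟨w,·⟩/‖w‖. As ∂_tF is odd it equals tH, and at t = ‖w‖ the
    -- singular quotient cancels. The result `D` is again smooth and even, so the induction
    -- continues.
    set D : ℝ × E → E →L[ℝ] G := fun p =>
      (fderiv ℝ F p).comp (ContinuousLinearMap.inr ℝ ℝ E) +
        (innerSL ℝ p.2).smulRight (H p) with hD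
    have hDs : ContDiff ℝ ∞ D := by
      refine (hfs.clm_comp contDiff_const).add ?_
      exact ((innerSL ℝ).contDiff.comp contDiff_snd).smulRight hHs
    have hDe : ∀ t w, D (-t, w) = D (t, w) := by
      intro t w
      have := hrefl (t, w)
      simp only at this
      simp only [hD, hHe, this]
      ext v
      simp
    have hder : ∀ w, HasFDerivAt (fun w => F (‖w‖, w)) (D (‖w‖, w)) w := by
      intro w
      by_cases hw : w = 0
      · subst hw
        -- At the vertex the norm is not differentiable, but it contributes nothing to first order
        -- because ∂_tF vanishes there.
        have h0 : fderiv ℝ F (0, 0) (1, 0) = 0 := by simpa using hH 0 0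
        have h1 := hFd ((0 : ℝ), (0 : E))
        rw [hasFDerivAt_iff_isLittleO_nhds_zero] at h1 ⊢
        have h2 : Tendsto (fun h : E => (‖h‖, h)) (𝓝 0) (𝓝 (0, 0)) := by
          have : Continuous (fun h : E => (‖h‖, h)) := by fun_prop
          simpa using this.tendsto 0
        have h3 := h1.comp_tendsto h2
        have h4 : (fun h : E => h) =O[𝓝 0] (fun h : E => h) := Asymptotics.isBigO_refl _ _
        have h5 : (fun h : E => (‖h‖, h)) =O[𝓝 0] (fun h : E => h) := h4.norm_left.prod_left h4
        refine (h3.trans_isBigO h5).congr_left fun h => ?_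
        have h6 : ((‖h‖, h) : ℝ × E) = ‖h‖ • ((1 : ℝ), (0 : E)) + (0, h) := by simp
        have h7 : fderiv ℝ F (0, 0) (‖h‖, h) = fderiv ℝ F (0, 0) (0, h) := by
          rw [h6, map_add, map_smul, h0, smul_zero, zero_add]
        simp [hD, h7]
      · have hn : HasFDerivAt (fun w : E => ‖w‖) (‖w‖⁻¹ • innerSL ℝ w) w := by
          have h1 := (hasStrictFDerivAt_norm_sq w).hasFDerivAt.sqrt (by simpa using hw)
          simp only [Real.sqrt_sq (norm_nonneg _)] at h1
          convert h1 using 1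
          ext v
          simp
          field_simp
        have h1 := HasFDerivAt.comp (f := fun w : E => (‖w‖, w)) w (hFd (‖w‖, w))
          (hn.prodMk (hasFDerivAt_id w))
        refine h1.congr_fderiv ?_
        ext v
        have h6 : ((‖w‖⁻¹ * inner ℝ w v, v) : ℝ × E) =
          (‖w‖⁻¹ * inner ℝ w v) • ((1 : ℝ), (0 : E)) + (0, v) := by simp
        simp only [hD, add_apply, ContinuousLinearMap.comp_apply,
          ContinuousLinearMap.inr_apply, ContinuousLinearMap.smulRight_apply,
          ContinuousLinearMap.prod_apply, smul_apply, innerSL_apply_apply,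
          ContinuousLinearMap.id_apply, smul_eq_mul]
        have h8 : ‖w‖⁻¹ * inner ℝ w v * ‖w‖ = inner ℝ w v := by
          field_simp
        rw [h6, map_add, map_smul, hH, smul_smul, add_comm, h8]
    push_cast
    rw [contDiff_succ_iff_hasFDerivAt]
    exact ⟨_, ih hDs hDe, hder⟩

/-- The restriction of a smooth function `F (t, w)` to the cone `t = ‖w‖` is of the form
`f₁ + ‖w‖ f₂` with smooth `f₁`, `f₂`. -/
theorem exists_contDiff_add_norm_smul {F : ℝ × E → G} (hF : ContDiff ℝ ∞ F) :
    ∃ f₁ f₂ : E → G, ContDiff ℝ ∞ f₁ ∧ ContDiff ℝ ∞ f₂ ∧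
      ∀ w, F (‖w‖, w) = f₁ w + ‖w‖ • f₂ w := by
  have hneg : ContDiff ℝ ∞ (fun p : ℝ × E => F (-p.1, p.2)) := hF.comp (by fun_prop)
  obtain ⟨H, hHs, hHe, hH⟩ := exists_even_of_odd
    (K := fun p => (1 / 2 : ℝ) • (F p - F (-p.1, p.2))) ((hF.sub hneg).const_smul _)
    (fun t w => by simp [← smul_neg])
  refine ⟨_, _, contDiff_comp_norm_of_even
    (F := fun p => (1 / 2 : ℝ) • (F p + F (-p.1, p.2))) ((hF.add hneg).const_smul _)
    (fun t w => by simp [add_comm]), contDiff_comp_norm_of_even hHs hHe, fun w => ?_⟩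
  rw [← hH]
  simp only
  module

end EvenOdd

end LightCone

namespace LightCone

open Set Filter Topology

/-! ### Algebra of Lorentzian forms. -/

section LorentzAlgebra

variable {n : ℕ}

theorem form_eq_toBilin' (G : Matrix (Fin (n + 1)) (Fin (n + 1)) ℝ) (X Y : Spacetime n) :
    form G X Y = Matrix.toBilin' G X Y := by
  rw [Matrix.toBilin'_apply, form]
  refine Finset.sum_congr rfl fun μ _ => Finset.sum_congr rfl fun ν _ => ?_
  ring

theorem form_comm {G : Matrix (Fin (n + 1)) (Fin (n + 1)) ℝ} (hG : G.IsSymm)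
    (X Y : Spacetime n) : form G X Y = form G Y X := by
  rw [form, Finset.sum_comm, form]
  refine Finset.sum_congr rfl fun μ _ => Finset.sum_congr rfl fun ν _ => ?_
  rw [hG.apply]
  ring

/-- Writing X = cT + Y with Y orthogonal to T, the expression is G(T,X)² - G(T,T)G(Y,Y), a sum of
nonnegative terms that vanish together only at X = 0. Positivity on a subspace depending on G thus
becomes positive definiteness on the whole space, which compactness of the unit sphere shows to be
an open condition. `IsLorentzian.of_pos` is the converse. -/
theorem IsLorentzian.exists_pos {G : Matrix (Fin (n + 1)) (Fin (n + 1)) ℝ}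
    (hG : IsLorentzian G) : ∃ T, form G T T < 0 ∧
      ∀ X, X ≠ 0 → 0 < 2 * form G T X ^ 2 - form G T T * form G X X := by
  obtain ⟨hs, T, hT, hpos⟩ := hG
  refine ⟨T, hT, fun X hX => ?_⟩
  set c := form G T X / form G T T with hc
  have hcT : c * form G T T = form G T X := div_mul_cancel₀ _ hT.ne
  have hcomm := form_comm hs X T
  have h1 : form G T (X - c • T) = 0 := by
    simp only [form_eq_toBilin', map_sub, map_smul, smul_eq_mul] at hcT ⊢
    linarith
  have h2 : form G (X - c • T) (X - c • T) = form G X X - c ^ 2 * form G T T := by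
    rw [← hcT] at hcomm
    simp only [form_eq_toBilin', map_sub, map_smul, smul_eq_mul, LinearMap.sub_apply,
      LinearMap.smul_apply] at hcomm hcT ⊢
    rw [hcomm, ← hcT]
    ring
  have h3 : 2 * form G T X ^ 2 - form G T T * form G X X =
      form G T X ^ 2 + (- form G T T) * form G (X - c • T) (X - c • T) := by
    rw [h2, ← hcT]
    ring
  rw [h3]
  by_cases hY : X - c • T = 0
  · have hX' : X = c • T := sub_eq_zero.1 hY
    have hc0 : c ≠ 0 := fun h => hX (by rw [hX', h, zero_smul])
    have : form G T X ≠ 0 := by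
      rw [← hcT]
      exact mul_ne_zero hc0 hT.ne
    rw [hY]
    simp only [form_eq_toBilin', map_zero, mul_zero, add_zero]
    rw [← form_eq_toBilin']
    positivity
  · have := mul_pos (neg_pos.2 hT) (hpos _ h1 hY)
    positivity

theorem IsLorentzian.of_pos {G : Matrix (Fin (n + 1)) (Fin (n + 1)) ℝ} (hs : G.IsSymm)
    {T : Spacetime n} (hT : form G T T < 0)
    (hpos : ∀ X, X ≠ 0 → 0 < 2 * form G T X ^ 2 - form G T T * form G X X) : IsLorentzian G := by
  refine ⟨hs, T, hT, fun X hX hX0 => ?_⟩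
  have := hpos X hX0
  rw [hX] at this
  by_contra! h
  nlinarith

theorem IsLorentzian.isUnit_det {G : Matrix (Fin (n + 1)) (Fin (n + 1)) ℝ}
    (hG : IsLorentzian G) : IsUnit G.det := by
  rw [isUnit_iff_ne_zero]
  intro h
  obtain ⟨X, hX, hGX⟩ := Matrix.exists_mulVec_eq_zero_iff.2 h
  obtain ⟨T, -, hpos⟩ := hG.exists_pos
  have h0 : ∀ Y, form G Y X = 0 := fun Y => by
    rw [form_eq_toBilin', Matrix.toBilin'_apply', hGX, dotProduct_zero]
  have := hpos X hX
  simp [h0] at this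

/-- In a Lorentzian space, a vector orthogonal to a null vector is spacelike or proportional
to it. -/
theorem IsLorentzian.form_pos_of_orthogonal_null {G : Matrix (Fin (n + 1)) (Fin (n + 1)) ℝ}
    (hG : IsLorentzian G) {l Y : Spacetime n} (hl0 : l ≠ 0) (hl : form G l l = 0)
    (hlY : form G l Y = 0) (hY : ∀ c : ℝ, Y ≠ c • l) : 0 < form G Y Y := by
  obtain ⟨hs, T, hT, hpos⟩ := hG
  have hTl : form G T l ≠ 0 := fun h => (hpos l h hl0).ne' hl
  -- Subtracting `c • l` makes `Y` orthogonal to `T` without changing G(Y,Y), because `l` is null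
  -- and orthogonal to `Y`.
  set c := form G T Y / form G T l with hc
  have hcT : c * form G T l = form G T Y := div_mul_cancel₀ _ hTl
  have hYl := form_comm hs Y l
  have h1 : form G T (Y - c • l) = 0 := by
    rw [form_eq_toBilin', map_sub, map_smul, ← form_eq_toBilin', ← form_eq_toBilin', smul_eq_mul,
      hcT, sub_self]
  have h2 := hpos _ h1 (sub_ne_zero.2 (hY c))
  rw [hlY] at hYl
  simp only [form_eq_toBilin', map_sub, map_smul, smul_eq_mul, LinearMap.sub_apply,
    LinearMap.smul_apply] at *
  rw [hl, hlY, hYl] at h2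
  linarith

/-- A symmetric form with a null vector `l` outside its radical, positive on the vectors which are
orthogonal but not proportional to `l`, is Lorentzian. -/
theorem IsLorentzian.of_null {G : Matrix (Fin (n + 1)) (Fin (n + 1)) ℝ} (hs : G.IsSymm)
    {l N : Spacetime n} (hl : form G l l = 0) (hlN : form G l N ≠ 0)
    (hpos : ∀ Y, form G l Y = 0 → (∀ c : ℝ, Y ≠ c • l) → 0 < form G Y Y) : IsLorentzian G := by
  -- The coefficient is chosen to make G(T,T) = -1.
  set T := N - ((form G N N + 1) / (2 * form G l N)) • l with hTdef
  have hTl : form G l T ≠ 0 := by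
    have : form G l T = form G l N := by
      simp only [hTdef, form_eq_toBilin', map_sub, map_smul, smul_eq_mul] at hl ⊢
      rw [hl]
      ring
    rwa [this]
  have hT : form G T T = -1 := by
    have hNl := form_comm hs N l
    simp only [hTdef, form_eq_toBilin', map_sub, map_smul, smul_eq_mul, LinearMap.sub_apply,
      LinearMap.smul_apply] at hl hlN hNl ⊢
    rw [hl, hNl]
    field_simp
    ring
  refine ⟨hs, T, by rw [hT]; norm_num, fun X hTX hX => ?_⟩
  set a := form G l X / form G l T with ha
  have haT : a * form G l T = form G l X := div_mul_cancel₀ _ hTl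
  set b := a / form G l T with hb
  have hbT : b * form G l T = a := div_mul_cancel₀ _ hTl
  have hlT := form_comm hs l T
  -- The coefficients make `Y` orthogonal to both `l` and `T`; for `X` orthogonal to `T` this yields
  -- G(X,X) = G(Y,Y) + a².
  set Y := X - a • T - b • l with hY
  have hXY : X = Y + a • T + b • l := by
    rw [hY]
    abel
  have hlY : form G l Y = 0 := by
    simp only [hY, form_eq_toBilin', map_sub, map_smul, smul_eq_mul] at hl haT ⊢
    rw [hl, haT]
    ring
  have hYl := form_comm hs Y l
  have hTY : form G T Y = 0 := by
    have h1 : form G T Y = form G T X - a * form G T T - b * form G T l := by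
      simp only [hY, form_eq_toBilin', map_sub, map_smul, smul_eq_mul]
    rw [h1, hTX, hT, ← hlT, hbT]
    ring
  have hYT := form_comm hs Y T
  have hXX : form G X X = form G Y Y + a ^ 2 := by
    have h1 : form G X X = form G Y Y + a * form G Y T + b * form G Y l + a * (form G T Y
        + a * form G T T + b * form G T l) + b * (form G l Y + a * form G l T + b * form G l l) := by
      rw [hXY]
      simp only [form_eq_toBilin', map_add, map_smul, smul_eq_mul, LinearMap.add_apply,
        LinearMap.smul_apply]
      ring
    rw [h1, hYT, hYl, hTY, hlY, hT, hl, ← hlT]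
    linear_combination 2 * a * hbT
  rw [hXX]
  by_cases hc : ∃ c : ℝ, Y = c • l
  · obtain ⟨c, hc⟩ := hc
    have h1 : c = 0 := by
      have h2 : form G T Y = c * form G T l := by
        rw [hc, form_eq_toBilin', map_smul, ← form_eq_toBilin', smul_eq_mul]
      rw [hTY, ← hlT] at h2
      simpa [hTl] using h2.symm
    have hY0 : Y = 0 := by rw [hc, h1, zero_smul]
    have ha0 : a ≠ 0 := by
      intro h
      refine hX ?_
      have hb0 : b = 0 := by rw [hb, h, zero_div]
      rw [hXY, hY0, h, hb0]
      simp
    rw [hY0, form_eq_toBilin', map_zero, zero_add]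
    positivity
  · have := hpos Y hlY (not_exists.1 hc)
    positivity

/-- Being Lorentzian is an open condition on symmetric matrices. -/
theorem IsLorentzian.eventually {Z : Type*} [TopologicalSpace Z]
    {g : Z → Matrix (Fin (n + 1)) (Fin (n + 1)) ℝ} {x : Z}
    (hg : ∀ μ ν, ContinuousAt (fun y => g y μ ν) x) (hs : ∀ᶠ y in 𝓝 x, (g y).IsSymm)
    (hL : IsLorentzian (g x)) : ∀ᶠ y in 𝓝 x, IsLorentzian (g y) := by
  obtain ⟨T, hT, hpos⟩ := hL.exists_pos
  have hc : ∀ X : Spacetime n, ContinuousAt (fun p : Z × Spacetime n => form (g p.1) p.2 p.2)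
      (x, X) ∧ ContinuousAt (fun p : Z × Spacetime n => form (g p.1) T p.2) (x, X) := by
    intro X
    have h1 : ∀ μ ν, ContinuousAt (fun p : Z × Spacetime n => g p.1 μ ν) (x, X) := fun μ ν =>
      ContinuousAt.comp (f := Prod.fst) (g := fun y => g y μ ν) (hg μ ν) continuousAt_fst
    constructor
    · unfold form
      refine tendsto_finsetSum _ fun μ _ => tendsto_finsetSum _ fun ν _ => ?_
      exact ((h1 μ ν).mul (by fun_prop)).mul (by fun_prop)
    · unfold form
      refine tendsto_finsetSum _ fun μ _ => tendsto_finsetSum _ fun ν _ => ?_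
      exact ((h1 μ ν).mul (by fun_prop)).mul (by fun_prop)
  have hTc : ContinuousAt (fun y => form (g y) T T) x :=
    ContinuousAt.comp (f := fun y => (y, T)) (g := fun p : Z × Spacetime n => form (g p.1) p.2 p.2)
      (hc T).1 (by fun_prop)
  -- The vector `T` found at `x` is kept for nearby points; the sphere suffices by homogeneity.
  have hS : ∀ᶠ y in 𝓝 x, ∀ X ∈ Metric.sphere (0 : Spacetime n) 1,
      0 < 2 * form (g y) T X ^ 2 - form (g y) T T * form (g y) X X := by
    refine (isCompact_sphere _ _).eventually_forall_of_forall_eventually fun X hX => ?_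
    have hX0 : X ≠ 0 := fun h => by simp [h] at hX
    have h1 : ContinuousAt (fun p : Z × Spacetime n =>
        2 * form (g p.1) T p.2 ^ 2 - form (g p.1) T T * form (g p.1) p.2 p.2) (x, X) := by
      refine (((hc X).2.pow 2).const_mul 2).sub (ContinuousAt.mul ?_ (hc X).1)
      exact ContinuousAt.comp (f := Prod.fst) (g := fun y => form (g y) T T) hTc continuousAt_fst
    exact h1.eventually_const_lt (hpos X hX0)
  filter_upwards [hs, hS, hTc.eventually_lt_const hT] with y hsy hSy hTy
  refine IsLorentzian.of_pos hsy hTy fun X hX => ?_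
  have hn : 0 < ‖X‖ := norm_pos_iff.2 hX
  have h1 := hSy (‖X‖⁻¹ • X) (by simp [norm_smul, hn.ne'])
  simp only [form_eq_toBilin', map_smul, LinearMap.smul_apply, smul_eq_mul] at h1 ⊢
  have h2 := mul_pos (pow_pos hn 2) h1
  refine h2.trans_eq ?_
  have h3 : ‖X‖ * ‖X‖⁻¹ = 1 := mul_inv_cancel₀ hn.ne'
  linear_combination (2 * (Matrix.toBilin' (g y) T X) ^ 2 * (‖X‖ * ‖X‖⁻¹ + 1) -
    (Matrix.toBilin' (g y) T T) * (Matrix.toBilin' (g y) X X) * (‖X‖ * ‖X‖⁻¹ + 1)) * h3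

theorem form_minkowski (X Y : Spacetime n) :
    form (minkowski n) X Y = - (X 0 * Y 0) + ∑ i : Fin n, X i.succ * Y i.succ := by
  simp [form, minkowski, Matrix.diagonal_apply, Fin.sum_univ_succ]

theorem minkowski_isSymm : (minkowski n).IsSymm := Matrix.isSymm_diagonal _

theorem isLorentzian_minkowski : IsLorentzian (minkowski n) := by
  refine ⟨minkowski_isSymm, Pi.single 0 1, by simp [form_minkowski], fun X hX hX0 => ?_⟩
  have h0 : X 0 = 0 := by simpa [form_minkowski] using hX
  rw [form_minkowski, h0]
  simp only [mul_zero, neg_zero, zero_add]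
  have h1 : ∃ i : Fin n, X i.succ ≠ 0 := by
    by_contra! h
    exact hX0 (funext fun μ => Fin.cases h0 h μ)
  obtain ⟨i, hi⟩ := h1
  exact Finset.sum_pos' (fun j _ => mul_self_nonneg _) ⟨i, Finset.mem_univ _, mul_self_pos.2 hi⟩

end LorentzAlgebra

/-! ### Geometry of the cone and `C_O`-smooth functions. -/

section ConeMap

variable {n : ℕ}

/-- The spatial part `w⃗` of `(w⁰, w⃗)`. -/
noncomputable def spatial (n : ℕ) : Spacetime n →L[ℝ] Space n :=
  (EuclideanSpace.equiv (Fin n) ℝ).symm.toContinuousLinearMap.comp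
    (ContinuousLinearMap.pi fun i : Fin n => ContinuousLinearMap.proj i.succ)

@[simp] theorem spatial_apply (x : Spacetime n) (i : Fin n) : spatial n x i = x i.succ := rfl

/-- The point `(t, w⃗)` of space-time. -/
noncomputable def ofTimeSpace (n : ℕ) : ℝ × Space n →L[ℝ] Spacetime n :=
  ContinuousLinearMap.pi (Fin.cases (ContinuousLinearMap.fst ℝ ℝ (Space n))
    fun i => (EuclideanSpace.proj i).comp (ContinuousLinearMap.snd ℝ ℝ (Space n)))

@[simp] theorem ofTimeSpace_zero (p : ℝ × Space n) : ofTimeSpace n p 0 = p.1 := rfl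

@[simp] theorem ofTimeSpace_succ (p : ℝ × Space n) (i : Fin n) :
    ofTimeSpace n p i.succ = p.2 i := rfl

@[simp] theorem spatial_ofTimeSpace (p : ℝ × Space n) : spatial n (ofTimeSpace n p) = p.2 := by
  ext i
  simp

theorem coneMap_eq (w : Space n) : coneMap n w = ofTimeSpace n (‖w‖, w) := by
  funext μ
  refine Fin.cases ?_ (fun i => ?_) μ <;> simp [coneMap]

@[simp] theorem coneMap_zero_apply (w : Space n) : coneMap n w 0 = ‖w‖ := rfl

@[simp] theorem coneMap_succ (w : Space n) (i : Fin n) : coneMap n w i.succ = w i := rfl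

@[simp] theorem spatial_coneMap (w : Space n) : spatial n (coneMap n w) = w := by
  rw [coneMap_eq, spatial_ofTimeSpace]

theorem coneMap_zero : coneMap n 0 = 0 := by
  rw [coneMap_eq, norm_zero]
  exact map_zero _

theorem coneMap_ne_zero {w : Space n} (hw : w ≠ 0) : coneMap n w ≠ 0 := fun h =>
  hw (by rw [← spatial_coneMap w, h, map_zero])

theorem coneMap_smul {t : ℝ} (ht : 0 ≤ t) (w : Space n) : coneMap n (t • w) = t • coneMap n w := by
  rw [coneMap_eq, coneMap_eq, ← map_smul, norm_smul, Real.norm_of_nonneg ht]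
  rfl

theorem continuous_coneMap : Continuous (coneMap n) := by
  have : coneMap n = fun w => ofTimeSpace n (‖w‖, w) := funext coneMap_eq
  rw [this]
  fun_prop

theorem contDiffAt_coneMap {w : Space n} (hw : w ≠ 0) : ContDiffAt ℝ ∞ (coneMap n) w := by
  have : coneMap n = fun w => ofTimeSpace n (‖w‖, w) := funext coneMap_eq
  rw [this]
  exact (ofTimeSpace n).contDiff.contDiffAt.comp w ((contDiffAt_norm ℝ hw).prodMk contDiffAt_id)

theorem inner_eq_sum (X Y : Space n) : inner ℝ X Y = ∑ i, X i * Y i := by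
  simp [PiLp.inner_apply, mul_comm]

theorem hasFDerivAt_norm_of_ne_zero {w : Space n} (hw : w ≠ 0) :
    HasFDerivAt (fun w : Space n => ‖w‖) (‖w‖⁻¹ • innerSL ℝ w) w := by
  have h1 := (hasStrictFDerivAt_norm_sq w).hasFDerivAt.sqrt (by simpa using hw)
  simp only [Real.sqrt_sq (norm_nonneg _)] at h1
  refine h1.congr_fderiv ?_
  ext v
  simp
  field_simp

theorem fderiv_coneMap {w : Space n} (hw : w ≠ 0) (X : Space n) :
    fderiv ℝ (coneMap n) w X = ofTimeSpace n (inner ℝ (theta w) X, X) := by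
  have h : coneMap n = fun w => ofTimeSpace n (‖w‖, w) := funext coneMap_eq
  have h1 : HasFDerivAt (coneMap n) ((ofTimeSpace n).comp
      ((‖w‖⁻¹ • innerSL ℝ w).prod (ContinuousLinearMap.id ℝ (Space n)))) w := by
    rw [h]
    exact (ofTimeSpace n).hasFDerivAt.comp w
      ((hasFDerivAt_norm_of_ne_zero hw).prodMk (hasFDerivAt_id w))
  rw [h1.fderiv]
  simp [theta, inner_smul_left]

theorem norm_theta {w : Space n} (hw : w ≠ 0) : ‖theta w‖ = 1 := by
  rw [theta, norm_smul, norm_inv, norm_norm, inv_mul_cancel₀ (norm_ne_zero_iff.2 hw)]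

/-- The differential of Θ is r⁻¹ times the orthogonal projection along Θ. -/
theorem norm_sq_mul_roundMetric {w : Space n} (hw : w ≠ 0) (X Y : Space n) :
    ‖w‖ ^ 2 * roundMetric w X Y =
      inner ℝ X Y - inner ℝ (theta w) X * inner ℝ (theta w) Y := by
  have hn : ‖w‖ ≠ 0 := norm_ne_zero_iff.2 hw
  have h1 : ∀ X, fderiv ℝ (theta (n := n)) w X =
      ‖w‖⁻¹ • (X - inner ℝ (theta w) X • theta w) := by
    intro X
    have h2 := ((hasDerivAt_inv hn).comp_hasFDerivAt w
      (hasFDerivAt_norm_of_ne_zero hw)).smul (hasFDerivAt_id w)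
    have h3 : fderiv ℝ (theta (n := n)) w = _ := HasFDerivAt.fderiv h2
    rw [h3]
    simp only [theta, inner_smul_left]
    ext i
    simp
    field_simp
    ring
  have h4 : inner ℝ (theta w) (theta w) = (1 : ℝ) := by
    rw [real_inner_self_eq_norm_sq, norm_theta hw, one_pow]
  rw [roundMetric, h1, h1]
  simp only [inner_smul_left, inner_smul_right, inner_sub_left, inner_sub_right, h4,
    real_inner_comm (theta w)]
  simp
  field_simp

theorem form_minkowski_fderiv_coneMap {w : Space n} (hw : w ≠ 0) (X Y : Space n) :
    form (minkowski n) (fderiv ℝ (coneMap n) w X) (fderiv ℝ (coneMap n) w Y) =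
      ‖w‖ ^ 2 * roundMetric w X Y := by
  rw [norm_sq_mul_roundMetric hw, fderiv_coneMap hw, fderiv_coneMap hw, form_minkowski,
    inner_eq_sum X Y]
  simp
  ring

theorem isOpen_ballR (R : ENNReal) : IsOpen (ballR n R) := Metric.isOpen_eball

theorem zero_mem_ballR {R : ENNReal} (hR : 0 < R) : (0 : Space n) ∈ ballR n R :=
  Metric.mem_eball_self hR

theorem smul_mem_ballR {R : ENNReal} {w : Space n} (hw : w ∈ ballR n R) {t : ℝ} (ht0 : 0 ≤ t)
    (ht1 : t ≤ 1) : t • w ∈ ballR n R := by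
  rw [ballR, Metric.mem_eball, edist_zero_right] at *
  refine lt_of_le_of_lt ?_ hw
  rw [enorm_smul]
  refine mul_le_of_le_one_left' ?_
  rw [← ofReal_norm, Real.norm_of_nonneg ht0]
  simpa using ht1

/-- The restriction to the cone of a function which is smooth near the cone is `C_O`-smooth. -/
theorem coSmoothOn_comp_coneMap {R : ENNReal} (hR : 0 < R) {U : Set (Spacetime n)}
    (hU : IsOpen U) (hcone : ∀ w ∈ ballR n R, coneMap n w ∈ U) {F : Spacetime n → ℝ}
    (hF : ContDiffOn ℝ ∞ F U) : COSmoothOn R (fun w => F (coneMap n w)) := by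
  have h0 : (0 : Spacetime n) ∈ U := by simpa [coneMap_zero] using hcone 0 (zero_mem_ballR hR)
  -- The even-odd splitting requires a globally defined function, so it is applied to bF. The
  -- remainder (1 - b)F vanishes on the cone near the vertex; elsewhere `coneMap` is smooth, so this
  -- remainder can be absorbed in f̂.
  obtain ⟨b, hbU⟩ : ∃ b : ContDiffBump (0 : Spacetime n), tsupport b ⊆ U := by
    obtain ⟨ε, hε, hεU⟩ := Metric.nhds_basis_closedBall.mem_iff.1 (hU.mem_nhds h0)
    refine ⟨⟨ε / 2, ε, by positivity, by linarith⟩, ?_⟩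
    rw [ContDiffBump.tsupport_eq]
    exact hεU
  have hbs : ContDiff ℝ ∞ b := b.contDiff
  have h1 : ContDiff ℝ ∞ (fun x => b x * F x) := by
    rw [contDiff_iff_contDiffAt]
    intro x
    by_cases hx : x ∈ tsupport b
    · exact hbs.contDiffAt.mul (hF.contDiffAt (hU.mem_nhds (hbU hx)))
    · refine contDiffAt_const (c := 0) |>.congr_of_eventuallyEq ?_
      filter_upwards [(isClosed_tsupport b).isOpen_compl.mem_nhds hx] with y hy
      rw [image_eq_zero_of_notMem_tsupport hy, zero_mul]
  obtain ⟨f₁, f₂, hf₁, hf₂, hf⟩ := exists_contDiff_add_norm_smul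
    (F := fun p : ℝ × Space n => b (ofTimeSpace n p) * F (ofTimeSpace n p))
    (h1.comp (ofTimeSpace n).contDiff)
  refine ⟨fun w => f₁ w + (1 - b (coneMap n w)) * F (coneMap n w), f₂, ?_, hf₂.contDiffOn, ?_⟩
  · refine hf₁.contDiffOn.add fun w hw => ContDiffAt.contDiffWithinAt ?_
    by_cases hw0 : w = 0
    · subst hw0
      refine contDiffAt_const (c := 0) |>.congr_of_eventuallyEq ?_
      have h2 : ∀ᶠ x in 𝓝 (coneMap n 0), b x = 1 := by
        rw [coneMap_zero]
        exact b.eventuallyEq_one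
      filter_upwards [continuous_coneMap.continuousAt.eventually h2] with y hy
      simp [hy]
    · have h3 := contDiffAt_coneMap hw0
      exact (contDiffAt_const.sub (hbs.contDiffAt.comp w h3)).mul
        ((hF.contDiffAt (hU.mem_nhds (hcone w hw))).comp w h3)
  · intro w _
    have h2 := hf w
    rw [← coneMap_eq, smul_eq_mul] at h2
    simp only
    linear_combination h2

/-- A `C_O`-smooth function extends to a smooth function on a cylinder in space-time. -/
theorem COSmoothOn.exists_extension {R : ENNReal} {f : Space n → ℝ} (hf : COSmoothOn R f) :
    ∃ F : Spacetime n → ℝ, ContDiffOn ℝ ∞ F (spatial n ⁻¹' ballR n R) ∧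
      ∀ w ∈ ballR n R, F (coneMap n w) = f w := by
  obtain ⟨f₁, f₂, hf₁, hf₂, hf⟩ := hf
  have hs : ContDiffOn ℝ ∞ (spatial n) (spatial n ⁻¹' ballR n R) := (spatial n).contDiff.contDiffOn
  refine ⟨fun x => f₁ (spatial n x) + x 0 * f₂ (spatial n x), ?_, fun w hw => ?_⟩
  · refine (hf₁.comp hs fun x hx => hx).add (ContDiffOn.mul ?_ (hf₂.comp hs fun x hx => hx))
    exact (contDiff_apply ℝ ℝ (0 : Fin (n + 1))).contDiffOn
  · simp [hf w hw]

end ConeMap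

end LightCone

namespace LightCone

open Set Filter Topology

/-! ### Derivatives along rays. -/

section Calculus

variable {n : ℕ}

theorem fderiv_eq_sum_partialDeriv (f : Spacetime n → ℝ) (x v : Spacetime n) :
    fderiv ℝ f x v = ∑ μ, v μ * partialDeriv μ f x := by
  conv_lhs => rw [pi_eq_sum_univ' v]
  rw [map_sum]
  refine Finset.sum_congr rfl fun μ _ => ?_
  rw [map_smul, smul_eq_mul, partialDeriv]

theorem contDiffOn_partialDeriv {U : Set (Spacetime n)} (hU : IsOpen U) {f : Spacetime n → ℝ}
    (hf : ContDiffOn ℝ ∞ f U) (μ : Fin (n + 1)) : ContDiffOn ℝ ∞ (partialDeriv μ f) U :=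
  (hf.fderiv_of_isOpen hU (by simp)).clm_apply contDiffOn_const

theorem hasFDerivAt_of_contDiffOn {U : Set (Spacetime n)} (hU : IsOpen U) {f : Spacetime n → ℝ}
    (hf : ContDiffOn ℝ ∞ f U) {x : Spacetime n} (hx : x ∈ U) :
    HasFDerivAt f (fderiv ℝ f x) x :=
  ((hf.contDiffAt (hU.mem_nhds hx)).differentiableAt (by simp)).hasFDerivAt

theorem hasDerivAt_comp_smul {U : Set (Spacetime n)} (hU : IsOpen U) {f : Spacetime n → ℝ}
    (hf : ContDiffOn ℝ ∞ f U) {x : Spacetime n} {t : ℝ} (hx : t • x ∈ U) :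
    HasDerivAt (fun t : ℝ => f (t • x)) (∑ μ, x μ * partialDeriv μ f (t • x)) t := by
  rw [← fderiv_eq_sum_partialDeriv]
  have h1 : HasDerivAt (fun t : ℝ => t • x) x t := by
    simpa using (hasDerivAt_id t).smul_const x
  exact (hasFDerivAt_of_contDiffOn hU hf hx).comp_hasDerivAt t h1

theorem partialDeriv_of_hasFDerivAt {f : Spacetime n → ℝ} {f' : Spacetime n →L[ℝ] ℝ}
    {x : Spacetime n} (h : HasFDerivAt f f' x) (μ : Fin (n + 1)) :
    partialDeriv μ f x = f' (Pi.single μ 1) := by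
  rw [partialDeriv, h.fderiv]

/-- Differentiation of an identity `∑ v_β x^β = f` which holds on an open set. -/
theorem sum_partialDeriv_mul_eq {U : Set (Spacetime n)} (hU : IsOpen U)
    {v : Fin (n + 1) → Spacetime n → ℝ} (hv : ∀ ν, ContDiffOn ℝ ∞ (v ν) U) {c : Spacetime n}
    (hvx : ∀ x ∈ U, ∑ β, v β x * x β = ∑ β, c β * x β) {x : Spacetime n} (hx : x ∈ U)
    (ν : Fin (n + 1)) :
    ∑ β, partialDeriv ν (v β) x * x β = c ν - v ν x := by
  have h1 : HasFDerivAt (fun y : Spacetime n => ∑ β, v β y * y β)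
      (∑ β, (v β x • ContinuousLinearMap.proj β + x β • fderiv ℝ (v β) x)) x :=
    HasFDerivAt.fun_sum fun β _ =>
      (hasFDerivAt_of_contDiffOn hU (hv β) hx).mul (hasFDerivAt_apply β x)
  have h2 : HasFDerivAt (fun y : Spacetime n => ∑ β, c β * y β)
      (∑ β, c β • (ContinuousLinearMap.proj β : Spacetime n →L[ℝ] ℝ)) x := by
    set A : Spacetime n →L[ℝ] ℝ := ∑ β, c β • (ContinuousLinearMap.proj β : Spacetime n →L[ℝ] ℝ) with hA
    have h : (fun y : Spacetime n => ∑ β, c β * y β) = A := by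
      funext y
      simp [hA]
    rw [h]
    exact A.hasFDerivAt
  have h3 : HasFDerivAt (fun y : Spacetime n => ∑ β, v β y * y β)
      (∑ β, c β • (ContinuousLinearMap.proj β : Spacetime n →L[ℝ] ℝ)) x := by
    refine h2.congr_of_eventuallyEq ?_
    filter_upwards [hU.mem_nhds hx] with y hy using hvx y hy
  have h4 := DFunLike.congr_fun (h1.unique h3) (Pi.single ν 1)
  simp only [sum_apply, add_apply, smul_apply,
    ContinuousLinearMap.proj_apply, smul_eq_mul, Pi.single_apply, mul_ite, mul_one, mul_zero,
    Finset.sum_add_distrib, Finset.sum_ite_eq', Finset.mem_univ, if_true] at h4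
  have h5 : ∑ β, partialDeriv ν (v β) x * x β = ∑ β, x β * fderiv ℝ (v β) x (Pi.single ν 1) :=
    Finset.sum_congr rfl fun β _ => mul_comm _ _
  rw [h5]
  linarith

theorem smul_mem_of_starConvex {U : Set (Spacetime n)} (hU : StarConvex ℝ 0 U) {x : Spacetime n}
    (hx : x ∈ U) {t : ℝ} (ht : t ∈ Icc (0 : ℝ) 1) : t • x ∈ U :=
  hU.smul_mem hx ht.1 ht.2

theorem eq_of_hasDerivAt_zero {f : ℝ → ℝ} (hf : ∀ t ∈ Icc (0 : ℝ) 1, HasDerivAt f 0 t) :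
    f 1 = f 0 := by
  have := intervalIntegral.integral_eq_sub_of_hasDerivAt (a := 0) (b := 1) (f := f)
    (f' := fun _ => 0) (by simpa using hf) (by simp)
  simp only [intervalIntegral.integral_zero] at this
  linarith

end Calculus

/-! ### The Gauss lemma and its converse. -/

section Normal

variable {n : ℕ}

/-- The geodesic expression `2 Γ_{ναβ} a^α a^β` with lowered index. -/
noncomputable def loweredGeodesic (g : Spacetime n → Matrix (Fin (n + 1)) (Fin (n + 1)) ℝ)
    (x a : Spacetime n) (ν : Fin (n + 1)) : ℝ :=
  ∑ α, ∑ β, (partialDeriv α (fun y => g y ν β) x + partialDeriv β (fun y => g y ν α) x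
      - partialDeriv ν (fun y => g y α β) x) * a α * a β

theorem christoffel_eq_zero_iff {g : Spacetime n → Matrix (Fin (n + 1)) (Fin (n + 1)) ℝ}
    {x a : Spacetime n} (hg : IsUnit (g x).det) :
    (∀ μ, ∑ α, ∑ β, christoffel g μ α β x * a α * a β = 0) ↔
      ∀ ν, loweredGeodesic g x a ν = 0 := by
  have h1 : ∀ μ, ∑ α, ∑ β, christoffel g μ α β x * a α * a β =
      1 / 2 * ((g x)⁻¹.mulVec (loweredGeodesic g x a)) μ := by
    intro μ
    simp only [christoffel, loweredGeodesic, Matrix.mulVec, dotProduct, Finset.mul_sum,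
      Finset.sum_mul]
    rw [eq_comm, Finset.sum_comm]
    refine Finset.sum_congr rfl fun α _ => ?_
    rw [Finset.sum_comm]
    exact Finset.sum_congr rfl fun β _ => Finset.sum_congr rfl fun ν _ => by ring
  simp only [h1, mul_eq_zero, one_div, inv_eq_zero, OfNat.ofNat_ne_zero, false_or]
  constructor
  · intro h ν
    have h2 : (g x)⁻¹.mulVec (loweredGeodesic g x a) = 0 := funext h
    have h3 : (g x).mulVec ((g x)⁻¹.mulVec (loweredGeodesic g x a)) = 0 := by
      rw [h2, Matrix.mulVec_zero]
    rw [Matrix.mulVec_mulVec, Matrix.mul_nonsing_inv _ hg, Matrix.one_mulVec] at h3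
    exact congrFun h3 ν
  · intro h μ
    have h2 : loweredGeodesic g x a = 0 := funext h
    rw [h2, Matrix.mulVec_zero]
    rfl

theorem loweredGeodesic_eq (g : Spacetime n → Matrix (Fin (n + 1)) (Fin (n + 1)) ℝ)
    (x a : Spacetime n) (ν : Fin (n + 1)) : loweredGeodesic g x a ν =
      2 * (∑ β, (∑ α, a α * partialDeriv α (fun y => g y ν β) x) * a β)
        - ∑ α, ∑ β, partialDeriv ν (fun y => g y α β) x * a α * a β := by
  have h1 : ∑ α, ∑ β, partialDeriv β (fun y => g y ν α) x * a α * a β =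
      ∑ β, (∑ α, a α * partialDeriv α (fun y => g y ν β) x) * a β := by
    refine Finset.sum_congr rfl fun α _ => ?_
    rw [Finset.sum_mul]
    exact Finset.sum_congr rfl fun β _ => by ring
  have h2 : ∑ α, ∑ β, partialDeriv α (fun y => g y ν β) x * a α * a β =
      ∑ β, (∑ α, a α * partialDeriv α (fun y => g y ν β) x) * a β := by
    rw [Finset.sum_comm]
    refine Finset.sum_congr rfl fun α _ => ?_
    rw [Finset.sum_mul]
    exact Finset.sum_congr rfl fun β _ => by ring
  simp only [loweredGeodesic, sub_mul, add_mul, Finset.sum_sub_distrib, Finset.sum_add_distrib]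
  rw [h1, h2]
  ring

/-- At x = ta the right-hand side is the derivative in t of g(a,a) along the ray, so the geodesic
equation makes the squared length of the velocity constant. -/
theorem sum_mul_loweredGeodesic (g : Spacetime n → Matrix (Fin (n + 1)) (Fin (n + 1)) ℝ)
    (x a : Spacetime n) : ∑ ν, a ν * loweredGeodesic g x a ν =
      ∑ ν, ∑ β, (∑ α, a α * partialDeriv α (fun y => g y ν β) x) * a ν * a β := by
  set S := ∑ ν, ∑ β, (∑ α, a α * partialDeriv α (fun y => g y ν β) x) * a ν * a β with hS
  have h1 : ∑ ν, a ν * ∑ β, (∑ α, a α * partialDeriv α (fun y => g y ν β) x) * a β = S := by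
    refine Finset.sum_congr rfl fun ν _ => ?_
    rw [Finset.mul_sum]
    exact Finset.sum_congr rfl fun β _ => by ring
  have h2 : ∑ ν, a ν * ∑ α, ∑ β, partialDeriv ν (fun y => g y α β) x * a α * a β = S := by
    simp only [hS, Finset.mul_sum, Finset.sum_mul]
    rw [Finset.sum_comm]
    refine Finset.sum_congr rfl fun α _ => ?_
    rw [Finset.sum_comm]
    refine Finset.sum_congr rfl fun β _ => Finset.sum_congr rfl fun γ _ => ?_
    ring
  simp only [loweredGeodesic_eq, mul_sub, Finset.sum_sub_distrib, h2]
  have h3 : ∀ ν, a ν * (2 * ∑ β, (∑ α, a α * partialDeriv α (fun y => g y ν β) x) * a β) =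
      2 * (a ν * ∑ β, (∑ α, a α * partialDeriv α (fun y => g y ν β) x) * a β) := fun ν => by ring
  simp only [h3]
  rw [← Finset.mul_sum, h1]
  ring

/-- The Gauss lemma: in normal coordinates, `g_{μν} x^ν = η_{μν} x^ν`. -/
theorem IsNormalOn.gauss {U : Set (Spacetime n)} (hU : IsOpen U) (hstar : StarConvex ℝ 0 U)
    {g : Spacetime n → Matrix (Fin (n + 1)) (Fin (n + 1)) ℝ} (hg : IsMetricOn U g)
    (hN : IsNormalOn U g) {x : Spacetime n} (hx : x ∈ U) (ν : Fin (n + 1)) :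
    ∑ β, g x ν β * x β = ∑ β, minkowski n ν β * x β := by
  obtain ⟨hgs, hgL⟩ := hg
  obtain ⟨h0, hgeo⟩ := hN
  have hL : ∀ x ∈ U, ∀ t ∈ Icc (0 : ℝ) 1, ∀ ν, loweredGeodesic g (t • x) x ν = 0 := by
    intro x hx t ht
    have htx := smul_mem_of_starConvex hstar hx ht
    exact (christoffel_eq_zero_iff (hgL _ htx).isUnit_det).1 (hgeo x t htx)
  have hq : ∀ x ∈ U, ∑ α, ∑ β, (g x α β - minkowski n α β) * x α * x β = 0 := by
    intro x hx
    have h1 := eq_of_hasDerivAt_zero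
      (f := fun t : ℝ => ∑ α, ∑ β, (g (t • x) α β - minkowski n α β) * x α * x β) (by
        intro t ht
        have htx := smul_mem_of_starConvex hstar hx ht
        have h2 := sum_mul_loweredGeodesic g (t • x) x
        simp only [hL x hx t ht, mul_zero, Finset.sum_const_zero] at h2
        rw [h2]
        refine HasDerivAt.fun_sum fun α _ => HasDerivAt.fun_sum fun β _ => ?_
        exact (((hasDerivAt_comp_smul hU (hgs α β) htx).sub_const _).mul_const _).mul_const _)
    simpa [h0] using h1
  -- This is the derivative of the identity `hq` in the direction ν.
  have hdq : ∀ x ∈ U, ∀ ν, (∑ α, ∑ β, partialDeriv ν (fun y => g y α β) x * x α * x β) +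
      2 * ∑ β, (g x ν β - minkowski n ν β) * x β = 0 := by
    intro x hx ν
    have hv : ∀ β, ContDiffOn ℝ ∞ (fun x => ∑ α, (g x α β - minkowski n α β) * x α) U :=
      fun β => ContDiffOn.sum fun α _ => ((hgs α β).sub contDiffOn_const).mul
        (contDiff_apply ℝ ℝ α).contDiffOn
    have h1 := sum_partialDeriv_mul_eq hU (c := 0) hv (fun x hx => by
      have h2 := hq x hx
      rw [Finset.sum_comm] at h2
      simpa [Finset.sum_mul] using h2) hx ν
    have hsymm : ∀ α, g x α ν - minkowski n α ν = g x ν α - minkowski n ν α := fun α => by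
      rw [(hgL x hx).1.apply, minkowski_isSymm.apply]
    simp only [Pi.zero_apply, zero_sub, hsymm] at h1
    have h2 : ∀ β, partialDeriv ν (fun x => ∑ α, (g x α β - minkowski n α β) * x α) x =
        (g x ν β - minkowski n ν β) + ∑ α, partialDeriv ν (fun y => g y α β) x * x α := by
      intro β
      have h3 : HasFDerivAt (fun x : Spacetime n => ∑ α, (g x α β - minkowski n α β) * x α)
          (∑ α, ((g x α β - minkowski n α β) • ContinuousLinearMap.proj α
            + x α • fderiv ℝ (fun y => g y α β) x)) x :=
        HasFDerivAt.fun_sum fun α _ =>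
          ((hasFDerivAt_of_contDiffOn hU (hgs α β) hx).sub_const _).mul (hasFDerivAt_apply α x)
      rw [partialDeriv_of_hasFDerivAt h3]
      simp only [sum_apply, add_apply, smul_apply,
        ContinuousLinearMap.proj_apply, smul_eq_mul, Pi.single_apply, mul_ite, mul_one, mul_zero,
        Finset.sum_add_distrib, Finset.sum_ite_eq', Finset.mem_univ, if_true, partialDeriv]
      congr 1
      exact Finset.sum_congr rfl fun α _ => mul_comm _ _
    simp only [h2, add_mul, Finset.sum_add_distrib, Finset.sum_mul] at h1
    rw [Finset.sum_comm]
    linarith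
  -- The geodesic equation reads 2F' = ∂_νg_{αβ}x^αx^β at tx, and `hdq` there says t²∂_νg_{αβ}x^αx^β
  -- + 2tF = 0. Together they give (tF)' = 0 for t ≠ 0, while F(0) = 0 covers t = 0. Thus F(1) = 0.
  set F : ℝ → ℝ := fun t => ∑ β, (g (t • x) ν β - minkowski n ν β) * x β with hF
  have h1 := eq_of_hasDerivAt_zero (f := fun t => t * F t) (by
    intro t ht
    have htx := smul_mem_of_starConvex hstar hx ht
    set F' := ∑ β, (∑ α, x α * partialDeriv α (fun y => g y ν β) (t • x)) * x β with hF'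
    have h2 : HasDerivAt F F' t := HasDerivAt.fun_sum fun β _ =>
      ((hasDerivAt_comp_smul hU (hgs ν β) htx).sub_const _).mul_const _
    have h3 := (hasDerivAt_id t).mul h2
    have h4 : 1 * F t + id t * F' = 0 := by
      simp only [one_mul, id]
      have h5 := hL x hx t ht ν
      rw [loweredGeodesic_eq] at h5
      have h6 := hdq (t • x) htx ν
      have h7 : ∑ α, ∑ β, partialDeriv ν (fun y => g y α β) (t • x) * (t • x) α * (t • x) β =
          t ^ 2 * ∑ α, ∑ β, partialDeriv ν (fun y => g y α β) (t • x) * x α * x β := by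
        simp only [Finset.mul_sum, Pi.smul_apply, smul_eq_mul]
        exact Finset.sum_congr rfl fun α _ => Finset.sum_congr rfl fun β _ => by ring
      have h8 : ∑ β, (g (t • x) ν β - minkowski n ν β) * (t • x) β = t * F t := by
        simp only [hF, Finset.mul_sum, Pi.smul_apply, smul_eq_mul]
        exact Finset.sum_congr rfl fun β _ => by ring
      rw [h7, h8] at h6
      by_cases ht0 : t = 0
      · simp [ht0, hF, h0]
      · refine mul_left_cancel₀ ht0 ?_
        linear_combination h6 / 2 + t ^ 2 / 2 * h5
    rw [h4] at h3
    exact h3)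
  simp only [hF, one_smul, one_mul, zero_mul, sub_mul, Finset.sum_sub_distrib] at h1
  linarith

/-- The converse of the Gauss lemma: if `g_{μν} x^ν = η_{μν} x^ν`, then the coordinates are
normal. -/
theorem isNormalOn_of_gauss {U : Set (Spacetime n)} (hU : IsOpen U)
    {g : Spacetime n → Matrix (Fin (n + 1)) (Fin (n + 1)) ℝ} (hg : IsMetricOn U g)
    (h0 : g 0 = minkowski n)
    (hgauss : ∀ x ∈ U, ∀ ν, ∑ β, g x ν β * x β = ∑ β, minkowski n ν β * x β) :
    IsNormalOn U g := by
  obtain ⟨hgs, hgL⟩ := hg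
  refine ⟨h0, fun a t hta => (christoffel_eq_zero_iff (hgL _ hta).isUnit_det).2 fun ν => ?_⟩
  have hd : ∀ x ∈ U, ∀ α ν, ∑ β, partialDeriv α (fun y => g y ν β) x * x β =
      minkowski n ν α - g x ν α := fun x hx α ν =>
    sum_partialDeriv_mul_eq hU (hgs ν) (fun x hx => hgauss x hx ν) hx α
  -- By `hd`, each contraction with x of a derivative of g is a component of η - g; a second
  -- contraction with x vanishes by the Gauss identity.
  have hself : ∀ x ∈ U, loweredGeodesic g x x ν = 0 := by
    intro x hx
    have h1 : ∑ β, (∑ α, x α * partialDeriv α (fun y => g y ν β) x) * x β = 0 := by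
      have h2 : ∑ α, x α * ∑ β, partialDeriv α (fun y => g y ν β) x * x β = 0 := by
        simp only [hd x hx]
        have h3 := hgauss x hx ν
        simp only [mul_comm (x _), sub_mul, Finset.sum_sub_distrib]
        linarith
      rw [← h2]
      simp only [Finset.mul_sum, Finset.sum_mul]
      rw [Finset.sum_comm]
      exact Finset.sum_congr rfl fun α _ => Finset.sum_congr rfl fun β _ => by ring
    have h4 : ∑ α, ∑ β, partialDeriv ν (fun y => g y α β) x * x α * x β = 0 := by
      have h5 : ∑ α, x α * ∑ β, partialDeriv ν (fun y => g y α β) x * x β = 0 := by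
        simp only [hd x hx]
        have h3 := hgauss x hx ν
        simp only [mul_comm (x _), sub_mul, Finset.sum_sub_distrib, minkowski_isSymm.apply ν,
          (hgL x hx).1.apply ν]
        linarith
      rw [← h5]
      simp only [Finset.mul_sum]
      exact Finset.sum_congr rfl fun α _ => Finset.sum_congr rfl fun β _ => by ring
    rw [loweredGeodesic_eq, h1, h4]
    ring
  have hne : ∀ s : ℝ, s ≠ 0 → s • a ∈ U → loweredGeodesic g (s • a) a ν = 0 := by
    intro s hs hsa
    have h1 := hself _ hsa
    have h2 : loweredGeodesic g (s • a) (s • a) ν = s ^ 2 * loweredGeodesic g (s • a) a ν := by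
      simp only [loweredGeodesic, Finset.mul_sum, Pi.smul_apply, smul_eq_mul]
      exact Finset.sum_congr rfl fun α _ => Finset.sum_congr rfl fun β _ => by ring
    rw [h2] at h1
    simpa [hs] using h1
  -- Homogeneity in the velocity settles t ≠ 0; the value at the origin follows by continuity along
  -- the ray.
  by_cases ht : t = 0
  · subst ht
    have hray : ContinuousAt (fun s : ℝ => s • a) 0 := by fun_prop
    have hpc : ∀ α β γ, ContinuousAt (fun s : ℝ => partialDeriv α (fun y => g y β γ) (s • a)) 0 :=
      fun α β γ => ContinuousAt.comp (f := fun s : ℝ => s • a)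
        (((contDiffOn_partialDeriv hU (hgs β γ) α).continuousOn).continuousAt (hU.mem_nhds hta))
        hray
    have hc : ContinuousAt (fun s : ℝ => loweredGeodesic g (s • a) a ν) 0 := by
      unfold loweredGeodesic
      refine tendsto_finsetSum _ fun α _ => tendsto_finsetSum _ fun β _ => ?_
      exact ((((hpc _ _ _).add (hpc _ _ _)).sub (hpc _ _ _)).mul continuousAt_const).mul
        continuousAt_const
    have h1 : Tendsto (fun s : ℝ => loweredGeodesic g (s • a) a ν) (𝓝[≠] 0) (𝓝 0) := by
      refine tendsto_const_nhds.congr' ?_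
      filter_upwards [self_mem_nhdsWithin,
        nhdsWithin_le_nhds (hray.eventually (hU.mem_nhds hta))] with s hs hsa
      exact (hne s hs hsa).symm
    exact tendsto_nhds_unique (hc.tendsto.mono_left nhdsWithin_le_nhds) h1
  · exact hne t ht hta

end Normal

end LightCone

namespace LightCone

open Set Filter Topology

/-! ### Radial homotopy and the curvature-like form of g - η. -/

section CurvatureForm

variable {n : ℕ}

/-- The coefficients of the homotopy formula which writes a 1-form `v` with `v_ν x^ν = 0` as
`v_ν = Q_{νβ} x^β` with antisymmetric `Q`. -/
noncomputable def radialHomotopy (v : Fin (n + 1) → Spacetime n → ℝ) (ν β : Fin (n + 1))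
    (x : Spacetime n) : ℝ :=
  ∫ s in (0 : ℝ)..1, s * (partialDeriv β (v ν) (s • x) - partialDeriv ν (v β) (s • x))

theorem radialHomotopy_antisymm (v : Fin (n + 1) → Spacetime n → ℝ) (ν β : Fin (n + 1))
    (x : Spacetime n) : radialHomotopy v ν β x = - radialHomotopy v β ν x := by
  rw [radialHomotopy, radialHomotopy, ← intervalIntegral.integral_neg]
  congr 1
  funext s
  ring

theorem radialHomotopy_neg (v : Fin (n + 1) → Spacetime n → ℝ) (ν β : Fin (n + 1))
    (x : Spacetime n) :
    radialHomotopy (fun μ y => - v μ y) ν β x = - radialHomotopy v ν β x := by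
  rw [radialHomotopy, radialHomotopy, ← intervalIntegral.integral_neg]
  congr 1
  funext s
  simp only [partialDeriv, fderiv_fun_neg, neg_apply]
  ring

section

variable {U : Set (Spacetime n)} (hU : IsOpen U) (hstar : StarConvex ℝ 0 U)
  {v : Fin (n + 1) → Spacetime n → ℝ} (hv : ∀ ν, ContDiffOn ℝ ∞ (v ν) U)

include hU hstar hv

theorem contDiffOn_radialHomotopy (ν β : Fin (n + 1)) :
    ContDiffOn ℝ ∞ (radialHomotopy v ν β) U := by
  have hc : ContDiff ℝ ∞ (fun p : ℝ × Spacetime n => p.1 • p.2) := contDiff_fst.smul contDiff_snd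
  refine contDiffOn_integral_unitInterval
    (F := fun p : ℝ × Spacetime n =>
      p.1 * (partialDeriv β (v ν) (p.1 • p.2) - partialDeriv ν (v β) (p.1 • p.2)))
    (hU.preimage hc.continuous) hU (fun x hx s hs => smul_mem_of_starConvex hstar hx hs) ?_
  exact contDiff_fst.contDiffOn.mul
    (((contDiffOn_partialDeriv hU (hv ν) β).comp hc.contDiffOn fun _ h => h).sub
      ((contDiffOn_partialDeriv hU (hv β) ν).comp hc.contDiffOn fun _ h => h))

theorem intervalIntegrable_radialHomotopy (ν β : Fin (n + 1)) {x : Spacetime n} (hx : x ∈ U) :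
    IntervalIntegrable
      (fun s : ℝ => s * (partialDeriv β (v ν) (s • x) - partialDeriv ν (v β) (s • x)))
      MeasureTheory.volume 0 1 := by
  refine ContinuousOn.intervalIntegrable ?_
  rw [uIcc_of_le zero_le_one]
  have hray : MapsTo (fun s : ℝ => s • x) (Icc 0 1) U := fun s hs =>
    smul_mem_of_starConvex hstar hx hs
  have hp : ∀ α β, ContinuousOn (fun s : ℝ => partialDeriv α (v β) (s • x)) (Icc 0 1) := fun α β =>
    (contDiffOn_partialDeriv hU (hv β) α).continuousOn.comp (by fun_prop) hray
  exact continuousOn_id.mul ((hp _ _).sub (hp _ _))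

/-- Integrate d/ds (s v_ν(sx)) = v_ν(sx) + s x^β ∂_βv_ν(sx) over [0,1]. Differentiating v_βx^β = 0
gives v_ν = -x^β ∂_νv_β, which turns the first term into the missing half of the curl. -/
theorem eq_sum_radialHomotopy (hvx : ∀ x ∈ U, ∑ ν, v ν x * x ν = 0) {x : Spacetime n}
    (hx : x ∈ U) (ν : Fin (n + 1)) : v ν x = ∑ β, radialHomotopy v ν β x * x β := by
  have hmem : ∀ s ∈ uIcc (0 : ℝ) 1, s • x ∈ U := fun s hs => by
    rw [uIcc_of_le zero_le_one] at hs
    exact smul_mem_of_starConvex hstar hx hs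
  have hint := fun β => intervalIntegrable_radialHomotopy hU hstar hv ν β hx
  have h1 := intervalIntegral.integral_eq_sub_of_hasDerivAt (a := 0) (b := 1)
    (f := fun s : ℝ => s * v ν (s • x))
    (f' := fun s : ℝ => ∑ β,
      s * (partialDeriv β (v ν) (s • x) - partialDeriv ν (v β) (s • x)) * x β) (by
      intro s hs
      have h2 := (hasDerivAt_id s).mul (hasDerivAt_comp_smul hU (hv ν) (hmem s hs))
      refine h2.congr_deriv ?_
      have h3 := sum_partialDeriv_mul_eq hU (c := 0) hv (by simpa using hvx) (hmem s hs) ν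
      simp only [Pi.smul_apply, smul_eq_mul, Pi.zero_apply, zero_sub] at h3
      have h4 : ∑ β, s * (partialDeriv β (v ν) (s • x) - partialDeriv ν (v β) (s • x)) * x β =
          s * ∑ β, x β * partialDeriv β (v ν) (s • x) -
            ∑ β, partialDeriv ν (v β) (s • x) * (s * x β) := by
        rw [Finset.mul_sum, ← Finset.sum_sub_distrib]
        exact Finset.sum_congr rfl fun β _ => by ring
      rw [h4, h3]
      simp only [id]
      ring) (by
        simpa only [Finset.sum_fn] using
          IntervalIntegrable.sum Finset.univ fun β _ => (hint β).mul_const (x β))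
  rw [intervalIntegral.integral_finsetSum fun β _ => (hint β).mul_const _] at h1
  simp only [intervalIntegral.integral_mul_const, one_smul, one_mul, zero_mul, sub_zero] at h1
  exact h1.symm

end

/-- A symmetric tensor field with `h_{μν} x^ν = 0` on a star-shaped set is of the form
`h_{μν} = Ω_{μανβ} x^α x^β`, where `Ω` is smooth and has the symmetries
`Ω_{μανβ} = Ω_{νβμα} = - Ω_{αμνβ}`. -/
theorem exists_curvatureForm {U : Set (Spacetime n)} (hU : IsOpen U) (hstar : StarConvex ℝ 0 U)
    {h : Fin (n + 1) → Fin (n + 1) → Spacetime n → ℝ} (hh : ∀ μ ν, ContDiffOn ℝ ∞ (h μ ν) U)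
    (hsymm : ∀ x ∈ U, ∀ μ ν, h μ ν x = h ν μ x)
    (hrad : ∀ x ∈ U, ∀ μ, ∑ ν, h μ ν x * x ν = 0) :
    ∃ Ω : Fin (n + 1) → Fin (n + 1) → Fin (n + 1) → Fin (n + 1) → Spacetime n → ℝ,
      (∀ μ α ν β, ContDiffOn ℝ ∞ (Ω μ α ν β) U) ∧
      (∀ x μ α ν β, Ω μ α ν β x = Ω ν β μ α x) ∧
      (∀ x μ α ν β, Ω μ α ν β x = - Ω α μ ν β x) ∧
      ∀ x ∈ U, ∀ μ ν, h μ ν x = ∑ α, ∑ β, Ω μ α ν β x * x α * x β := by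
  set P : Fin (n + 1) → Fin (n + 1) → Fin (n + 1) → Spacetime n → ℝ :=
    fun μ ν β => radialHomotopy (h μ) ν β with hP
  have hPs : ∀ μ ν β, ContDiffOn ℝ ∞ (P μ ν β) U := fun μ ν β =>
    contDiffOn_radialHomotopy hU hstar (hh μ) ν β
  -- This allows the homotopy to be repeated in the index μ. Contracting the curl of h_{μ·} with x^μ
  -- gives h_{νβ} - h_{βν}, which is zero.
  have hPx : ∀ ν β, ∀ x ∈ U, ∑ μ, P μ ν β x * x μ = 0 := by
    intro ν β x hx
    have hint := fun μ => intervalIntegrable_radialHomotopy hU hstar (hh μ) ν β hx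
    have h1 : ∑ μ, P μ ν β x * x μ = ∫ s in (0 : ℝ)..1, ∑ μ,
        s * (partialDeriv β (h μ ν) (s • x) - partialDeriv ν (h μ β) (s • x)) * x μ := by
      rw [intervalIntegral.integral_finsetSum fun μ _ => (hint μ).mul_const _]
      simp only [intervalIntegral.integral_mul_const]
      rfl
    rw [h1]
    refine (intervalIntegral.integral_congr fun s hs => ?_).trans
      intervalIntegral.integral_zero
    rw [uIcc_of_le zero_le_one] at hs
    have hsx := smul_mem_of_starConvex hstar hx hs
    have h2 : ∀ ν, ∀ x ∈ U, ∑ μ, h μ ν x * x μ = ∑ μ, (0 : Spacetime n) μ * x μ := by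
      intro ν x hx
      have := hrad x hx ν
      simpa [hsymm x hx ν] using this
    have h3 := fun ν β => sum_partialDeriv_mul_eq hU (fun μ => hh μ ν) (h2 ν) hsx β
    have h4 := h3 ν β
    have h5 := h3 β ν
    simp only [Pi.zero_apply, zero_sub, Pi.smul_apply, smul_eq_mul] at h4 h5 ⊢
    rw [hsymm _ hsx, ← h5] at h4
    rw [← sub_eq_zero, ← Finset.sum_sub_distrib] at h4
    rw [← h4]
    exact Finset.sum_congr rfl fun μ _ => by ring
  have hPanti : ∀ μ ν β, P μ ν β = fun x => - P μ β ν x := fun μ ν β =>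
    funext fun x => radialHomotopy_antisymm _ _ _ _
  set Q : Fin (n + 1) → Fin (n + 1) → Fin (n + 1) → Fin (n + 1) → Spacetime n → ℝ :=
    fun μ α ν β => radialHomotopy (fun μ => P μ ν β) μ α with hQ
  have hQs : ∀ μ α ν β, ContDiffOn ℝ ∞ (Q μ α ν β) U := fun μ α ν β =>
    contDiffOn_radialHomotopy hU hstar (fun μ => hPs μ ν β) μ α
  have hQ1 : ∀ x μ α ν β, Q μ α ν β x = - Q α μ ν β x := fun x μ α ν β =>
    radialHomotopy_antisymm _ _ _ _
  have hQ2 : ∀ x μ α ν β, Q μ α ν β x = - Q μ α β ν x := fun x μ α ν β => by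
    simp only [hQ]
    rw [← radialHomotopy_neg]
    simp only [hPanti _ ν β]
  have hQh : ∀ x ∈ U, ∀ μ ν, h μ ν x = ∑ α, ∑ β, Q μ α ν β x * x α * x β := by
    intro x hx μ ν
    rw [eq_sum_radialHomotopy hU hstar (hh μ) (fun x hx => hrad x hx μ) hx ν, Finset.sum_comm]
    refine Finset.sum_congr rfl fun β _ => ?_
    rw [← Finset.sum_mul]
    congr 1
    exact eq_sum_radialHomotopy hU hstar (fun μ => hPs μ ν β) (hPx ν β) hx μ
  -- `Q` is antisymmetric in each pair; averaging adds the pair exchange, and the contraction is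
  -- unchanged because h is symmetric.
  refine ⟨fun μ α ν β x => (Q μ α ν β x + Q ν β μ α x) / 2,
    fun μ α ν β => ((hQs _ _ _ _).add (hQs _ _ _ _)).div_const _,
    fun x μ α ν β => by ring, fun x μ α ν β => ?_, fun x hx μ ν => ?_⟩
  · linear_combination (hQ1 x μ α ν β) / 2 + (hQ2 x ν β μ α) / 2
  · have h1 : ∑ α, ∑ β, Q ν β μ α x * x α * x β = h μ ν x := by
      rw [hsymm x hx, hQh x hx, Finset.sum_comm]
      exact Finset.sum_congr rfl fun α _ => Finset.sum_congr rfl fun β _ => by ring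
    have h2 : ∑ α, ∑ β, (Q μ α ν β x + Q ν β μ α x) / 2 * x α * x β =
        ((∑ α, ∑ β, Q μ α ν β x * x α * x β) + ∑ α, ∑ β, Q ν β μ α x * x α * x β) / 2 := by
      simp only [← Finset.sum_add_distrib, Finset.sum_div]
      exact Finset.sum_congr rfl fun α _ => Finset.sum_congr rfl fun β _ => by ring
    rw [h2, h1, ← hQh x hx]
    ring

end CurvatureForm

end LightCone

namespace LightCone

open Set Filter Topology

/-! ### Pull-back to the cone and tensors with curvature symmetries. -/

section ConeFormula

variable {n : ℕ}

/-- The symmetries `Ω_{μανβ} = Ω_{νβμα} = - Ω_{αμνβ}` of the coefficients at a point. -/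
def HasCurvatureSymmetries {ι : Type*} (Ω : ι → ι → ι → ι → ℝ) : Prop :=
  ∀ μ α ν β, Ω μ α ν β = Ω ν β μ α ∧ Ω μ α ν β = - Ω α μ ν β

/-- The symmetric tensor `Ω_{μανβ} x^α x^β`. -/
def quadraticTensor {ι : Type*} [Fintype ι] (Ω : ι → ι → ι → ι → ℝ) (x : ι → ℝ) (μ ν : ι) : ℝ :=
  ∑ α, ∑ β, Ω μ α ν β * x α * x β

namespace HasCurvatureSymmetries

section

variable {ι : Type*} {Ω : ι → ι → ι → ι → ℝ} (hΩ : HasCurvatureSymmetries Ω)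

include hΩ

theorem antisymm_right (μ α ν β : ι) : Ω μ α ν β = - Ω μ α β ν := by
  rw [(hΩ μ α ν β).1, (hΩ ν β μ α).2, (hΩ β ν μ α).1]

variable [Fintype ι]

theorem quadraticTensor_comm (x : ι → ℝ) (μ ν : ι) :
    quadraticTensor Ω x μ ν = quadraticTensor Ω x ν μ := by
  rw [quadraticTensor, Finset.sum_comm, quadraticTensor]
  refine Finset.sum_congr rfl fun α _ => Finset.sum_congr rfl fun β _ => ?_
  rw [(hΩ μ β ν α).1]
  ring

/-- Antisymmetry in the last pair meets the symmetric product x^νx^β. This is the Gauss identity for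
η + Ω_{μανβ}x^αx^β. -/
theorem sum_quadraticTensor_mul (x : ι → ℝ) (μ : ι) :
    ∑ ν, quadraticTensor Ω x μ ν * x ν = 0 := by
  have h1 : ∀ α, ∑ ν, ∑ β, Ω μ α ν β * x α * x β * x ν = 0 := by
    intro α
    have h2 : ∑ ν, ∑ β, Ω μ α ν β * x α * x β * x ν =
        - ∑ ν, ∑ β, Ω μ α ν β * x α * x β * x ν := by
      conv_lhs => rw [Finset.sum_comm]
      simp only [← Finset.sum_neg_distrib]
      refine Finset.sum_congr rfl fun β _ => Finset.sum_congr rfl fun ν _ => ?_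
      rw [hΩ.antisymm_right μ α ν β]
      ring
    linarith
  simp only [quadraticTensor, Finset.sum_mul]
  rw [Finset.sum_comm]
  exact Finset.sum_eq_zero fun α _ => h1 α

end

/-- The pull-back to the cone of `Ω_{μανβ} x^α x^β`. -/
theorem form_quadraticTensor_coneMap {Ω : Fin (n + 1) → Fin (n + 1) → Fin (n + 1) → Fin (n + 1) → ℝ}
    (hΩ : HasCurvatureSymmetries Ω) {w : Space n} (hw : w ≠ 0) (p q : Fin n) :
    form (Matrix.of (quadraticTensor Ω (coneMap n w)))
        (fderiv ℝ (coneMap n) w (basisVec p)) (fderiv ℝ (coneMap n) w (basisVec q)) =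
      (∑ i : Fin n, ∑ j : Fin n, Ω 0 i.succ 0 j.succ * w i * w j * theta w p * theta w q)
        + (∑ k : Fin n, w k * ((∑ i : Fin n, Ω 0 i.succ q.succ k.succ * w i * theta w p)
          + ∑ j : Fin n, Ω 0 j.succ p.succ k.succ * w j * theta w q))
        + ‖w‖ ^ 2 * Ω 0 p.succ 0 q.succ
        - (∑ i : Fin n, Ω 0 i.succ 0 q.succ * w i * w p)
        - (∑ i : Fin n, Ω 0 p.succ 0 i.succ * w i * w q)
        - ∑ k : Fin n, (‖w‖ * Ω 0 p.succ q.succ k.succ + ‖w‖ * Ω 0 q.succ p.succ k.succ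
          - ∑ l : Fin n, Ω p.succ k.succ q.succ l.succ * w l) * w k := by
  have hz1 : ∀ ν β, Ω 0 0 ν β = 0 := fun ν β => by
    have := (hΩ 0 0 ν β).2
    linarith
  have hz2 : ∀ μ α, Ω μ α 0 0 = 0 := fun μ α => by rw [(hΩ μ α 0 0).1, hz1]
  have hth : ∀ p, w p = ‖w‖ * theta w p := fun p => by
    have : ‖w‖ ≠ 0 := norm_ne_zero_iff.2 hw
    simp [theta]
    field_simp
  have hinner : ∀ p, inner ℝ (theta w) (basisVec p) = theta w p := fun p => by
    simp [basisVec, EuclideanSpace.inner_single_right]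
  have hd : ∀ p, fderiv ℝ (coneMap n) w (basisVec p) = ofTimeSpace n (theta w p, basisVec p) :=
    fun p => by rw [fderiv_coneMap hw, hinner]
  set H := quadraticTensor Ω (coneMap n w) with hH
  -- The cone's tangent vectors are (Θ^p, ∂_p), so each of the four blocks of `H` contributes. The
  -- terms with w^p and w^q come from the factor r in H_{0q} and H_{p0}, through rΘ^p = w^p.
  have hform : form (Matrix.of H) (ofTimeSpace n (theta w p, basisVec p))
      (ofTimeSpace n (theta w q, basisVec q)) = H 0 0 * theta w p * theta w q
        + H 0 q.succ * theta w p + H p.succ 0 * theta w q + H p.succ q.succ := by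
    simp [form, Fin.sum_univ_succ, basisVec, Finset.sum_add_distrib]
    ring
  have hH00 : H 0 0 = ∑ i : Fin n, ∑ j : Fin n, Ω 0 i.succ 0 j.succ * w i * w j := by
    simp [hH, quadraticTensor, Fin.sum_univ_succ, hz1, hz2]
  have hH0 : ∀ q : Fin n, H 0 q.succ = (∑ k : Fin n, w k * ∑ i : Fin n,
      Ω 0 i.succ q.succ k.succ * w i) - ‖w‖ * ∑ i : Fin n, Ω 0 i.succ 0 q.succ * w i := by
    intro q
    simp only [hH, quadraticTensor, Fin.sum_univ_succ, hz1, coneMap_zero_apply, coneMap_succ,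
      neg_zero, zero_mul, Finset.sum_const_zero, zero_add, Finset.sum_add_distrib,
      hΩ.antisymm_right 0 _ q.succ 0, Finset.mul_sum]
    rw [Finset.sum_comm, add_comm, sub_eq_add_neg, ← Finset.sum_neg_distrib]
    congr 1
    · exact Finset.sum_congr rfl fun k _ => Finset.sum_congr rfl fun i _ => by ring
    · exact Finset.sum_congr rfl fun i _ => by ring
  have hHpq : H p.succ q.succ = ‖w‖ ^ 2 * Ω 0 p.succ 0 q.succ
      - ∑ k : Fin n, (‖w‖ * Ω 0 p.succ q.succ k.succ + ‖w‖ * Ω 0 q.succ p.succ k.succ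
          - ∑ l : Fin n, Ω p.succ k.succ q.succ l.succ * w l) * w k := by
    have h1 : Ω p.succ 0 q.succ 0 = Ω 0 p.succ 0 q.succ := by
      rw [(hΩ _ _ _ _).2, hΩ.antisymm_right, neg_neg]
    have h2 : ∀ k : Fin n, Ω p.succ 0 q.succ k.succ = - Ω 0 p.succ q.succ k.succ := fun k =>
      (hΩ _ _ _ _).2
    have h3 : ∀ k : Fin n, Ω p.succ k.succ q.succ 0 = - Ω 0 q.succ p.succ k.succ := fun k => by
      rw [(hΩ _ _ _ _).1, (hΩ _ _ _ _).2]
    simp only [hH, quadraticTensor, Fin.sum_univ_succ, coneMap_zero_apply, coneMap_succ,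
      Finset.sum_add_distrib, h1, h2, h3, sub_mul, add_mul, Finset.sum_sub_distrib, Finset.sum_mul]
    have h4 : ∑ x : Fin n, -Ω 0 p.succ q.succ x.succ * ‖w‖ * w x =
        - ∑ x : Fin n, ‖w‖ * Ω 0 p.succ q.succ x.succ * w x := by
      rw [← Finset.sum_neg_distrib]
      exact Finset.sum_congr rfl fun k _ => by ring
    have h5 : ∑ x : Fin n, -Ω 0 q.succ p.succ x.succ * w x * ‖w‖ =
        - ∑ x : Fin n, ‖w‖ * Ω 0 q.succ p.succ x.succ * w x := by
      rw [← Finset.sum_neg_distrib]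
      exact Finset.sum_congr rfl fun k _ => by ring
    have h6 : ∑ k : Fin n, ∑ l : Fin n, Ω p.succ k.succ q.succ l.succ * w k * w l =
        ∑ k : Fin n, ∑ l : Fin n, Ω p.succ k.succ q.succ l.succ * w l * w k :=
      Finset.sum_congr rfl fun k _ => Finset.sum_congr rfl fun l _ => by ring
    rw [h4, h5, h6]
    ring
  have hAp : ∑ i : Fin n, Ω 0 i.succ 0 p.succ * w i = ∑ i : Fin n, Ω 0 p.succ 0 i.succ * w i :=
    Finset.sum_congr rfl fun i _ => by rw [(hΩ _ _ _ _).1]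
  have hcomm : H p.succ 0 = H 0 p.succ := hΩ.quadraticTensor_comm _ _ _
  rw [hd, hd, hform, hcomm, hH00, hH0, hH0, hHpq, hAp]
  simp only [mul_add, Finset.sum_add_distrib, ← Finset.sum_mul, ← mul_assoc]
  rw [hth p, hth q]
  ring

end HasCurvatureSymmetries

theorem form_add (G H : Matrix (Fin (n + 1)) (Fin (n + 1)) ℝ) (X Y : Spacetime n) :
    form (G + H) X Y = form G X Y + form H X Y := by
  simp [form, add_mul, Finset.sum_add_distrib]

/-- The tensor `Ω` with `Ω_{0i0j} = a_{ij}`, `Ω_{0ijk} = b_{ijk}` and `Ω_{ijkl} = c_{ijkl}`. -/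
def tensorOfCoeffs (a : Fin n → Fin n → ℝ) (b : Fin n → Fin n → Fin n → ℝ)
    (c : Fin n → Fin n → Fin n → Fin n → ℝ) (μ α ν β : Fin (n + 1)) : ℝ :=
  Fin.cases
    (Fin.cases 0 (fun i => Fin.cases
      (Fin.cases 0 (fun j => a i j) β)
      (fun j => Fin.cases (-a i j) (fun k => b i j k) β) ν) α)
    (fun i => Fin.cases
      (Fin.cases (Fin.cases 0 (fun k => -a i k) β)
        (fun k => Fin.cases (a i k) (fun l => -b i k l) β) ν)
      (fun j => Fin.cases (Fin.cases 0 (fun k => b k i j) β)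
        (fun k => Fin.cases (-b k i j) (fun l => c i j k l) β) ν) α) μ

theorem hasCurvatureSymmetries_tensorOfCoeffs {a : Fin n → Fin n → ℝ}
    {b : Fin n → Fin n → Fin n → ℝ} {c : Fin n → Fin n → Fin n → Fin n → ℝ}
    (ha : ∀ i j, a i j = a j i) (hb : ∀ i j k, b i j k = - b i k j)
    (hc : ∀ i j k l, c i j k l = c k l i j ∧ c i j k l = - c j i k l) :
    HasCurvatureSymmetries (tensorOfCoeffs a b c) := by
  intro μ α ν β
  constructor
  · cases μ using Fin.cases <;> cases α using Fin.cases <;> cases ν using Fin.cases <;>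
      cases β using Fin.cases <;> simp only [tensorOfCoeffs, Fin.cases_zero, Fin.cases_succ]
    all_goals first | rw [ha] | rw [(hc _ _ _ _).1]
  · cases μ using Fin.cases <;> cases α using Fin.cases <;> cases ν using Fin.cases <;>
      cases β using Fin.cases <;>
      simp only [tensorOfCoeffs, Fin.cases_zero, Fin.cases_succ, neg_zero, neg_neg]
    · rw [hb]
    · rw [hb, neg_neg]
    · rw [(hc _ _ _ _).2]

/-- The projection of a 4-tensor onto the tensors with the symmetries of `Ω`. -/
noncomputable def symmetrize {ι : Type*} (T : ι → ι → ι → ι → ℝ) (μ α ν β : ι) : ℝ :=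
  (T μ α ν β - T α μ ν β - T μ α β ν + T α μ β ν
    + T ν β μ α - T β ν μ α - T ν β α μ + T β ν α μ) / 8

theorem hasCurvatureSymmetries_symmetrize {ι : Type*} (T : ι → ι → ι → ι → ℝ) :
    HasCurvatureSymmetries (symmetrize T) := fun μ α ν β =>
  ⟨by unfold symmetrize; ring, by unfold symmetrize; ring⟩

theorem HasCurvatureSymmetries.symmetrize_eq {ι : Type*} {T : ι → ι → ι → ι → ℝ}
    (hT : HasCurvatureSymmetries T) : symmetrize T = T := by
  funext μ α ν β
  have h1 := hT μ α ν β
  have h2 := hT.antisymm_right μ α ν β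
  have h3 := hT.antisymm_right α μ ν β
  have h4 := hT ν β μ α
  have h5 := hT.antisymm_right ν β μ α
  have h6 := hT.antisymm_right β ν μ α
  rw [symmetrize]
  linarith [h1.1, h1.2, h4.2]

end ConeFormula

end LightCone

namespace LightCone

open Set Filter Topology

/-! ### The two implications and the signature. -/

section Main

variable {n : ℕ}

theorem hasConeForm_of_metric {R : ENNReal} (hR : 0 < R)
    {φ : Space n → LinearMap.BilinForm ℝ (Space n)} (h : IsConeRestriction R φ) :
    HasConeForm R φ := by
  obtain ⟨U, g, hU, hstar, hcone, hg, hN, hφ⟩ := h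
  have hgauss := fun x hx ν => hN.gauss hU hstar hg (x := x) hx ν
  obtain ⟨Ω, hΩs, hΩ1, hΩ2, hΩ⟩ := exists_curvatureForm hU hstar
    (h := fun μ ν x => g x μ ν - minkowski n μ ν)
    (fun μ ν => (hg.1 μ ν).sub contDiffOn_const)
    (fun x hx μ ν => by rw [(hg.2 x hx).1.apply, minkowski_isSymm.apply])
    (fun x hx μ => by
      simp only [sub_mul, Finset.sum_sub_distrib]
      rw [hgauss x hx, sub_self])
  have hsym : ∀ x, HasCurvatureSymmetries (fun μ α ν β => Ω μ α ν β x) := fun x μ α ν β =>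
    ⟨hΩ1 x μ α ν β, hΩ2 x μ α ν β⟩
  have hs := fun μ α ν β => coSmoothOn_comp_coneMap hR hU hcone (hΩs μ α ν β)
  refine ⟨fun i j w => Ω 0 i.succ 0 j.succ (coneMap n w),
    fun i j k w => Ω 0 i.succ j.succ k.succ (coneMap n w),
    fun i j k l w => Ω i.succ j.succ k.succ l.succ (coneMap n w),
    fun _ _ => hs _ _ _ _, fun _ _ _ => hs _ _ _ _, fun _ _ _ _ => hs _ _ _ _,
    fun w _ i j => hΩ1 _ _ _ _ _, fun w _ i j k => (hsym _).antisymm_right _ _ _ _,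
    fun w _ i j k l => ⟨hΩ1 _ _ _ _ _, hΩ2 _ _ _ _ _⟩, fun w hw hw0 p q => ?_⟩
  have hG : g (coneMap n w) = minkowski n +
      Matrix.of (quadraticTensor (fun μ α ν β => Ω μ α ν β (coneMap n w)) (coneMap n w)) := by
    ext μ ν
    have := hΩ (coneMap n w) (hcone w hw) μ ν
    simp only [Matrix.add_apply, Matrix.of_apply, quadraticTensor]
    linarith
  rw [hφ w hw hw0, hG, form_add, form_minkowski_fderiv_coneMap hw0, add_sub_cancel_left,
    (hsym _).form_quadraticTensor_coneMap hw0]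

/-- Against the position vector, G may be replaced by η; in particular this vector is null for G and
its orthogonal complement does not depend on G. -/
theorem form_coneMap_of_gauss {G : Matrix (Fin (n + 1)) (Fin (n + 1)) ℝ} (hs : G.IsSymm)
    {w : Space n} (hG : ∀ ν, ∑ β, G ν β * coneMap n w β = ∑ β, minkowski n ν β * coneMap n w β)
    (Y : Spacetime n) :
    form G (coneMap n w) Y = - (‖w‖ * Y 0) + inner ℝ w (spatial n Y) := by
  have h1 : form G (coneMap n w) Y = form (minkowski n) (coneMap n w) Y := by
    rw [form_comm hs, form_comm minkowski_isSymm]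
    simp only [form, mul_right_comm _ (Y _), ← Finset.sum_mul, hG]
  rw [h1, form_minkowski, inner_eq_sum]
  rfl

/-- An angular vector X lifts to (0, X), which is orthogonal to the null position vector and not a
multiple of it, hence spacelike. -/
theorem isPosDefOn_of_metric {R : ENNReal} {φ : Space n → LinearMap.BilinForm ℝ (Space n)}
    (h : IsConeRestriction R φ) : IsPosDefOn R φ := by
  obtain ⟨U, g, hU, hstar, hcone, hg, hN, hφ⟩ := h
  intro w hw hw0 X hX hX0
  have hL := hg.2 _ (hcone w hw)
  have hform := form_coneMap_of_gauss hL.1 (fun ν => hN.gauss hU hstar hg (hcone w hw) ν)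
  rw [hφ w hw hw0]
  have hin : inner ℝ (theta w) X = (0 : ℝ) := by rw [theta, inner_smul_left, hX, mul_zero]
  rw [fderiv_coneMap hw0, hin]
  refine hL.form_pos_of_orthogonal_null (coneMap_ne_zero hw0) ?_ ?_ fun c hc => ?_
  · rw [hform, spatial_coneMap, real_inner_self_eq_norm_sq, coneMap_zero_apply]
    ring
  · rw [hform, spatial_ofTimeSpace, ofTimeSpace_zero, hX]
    simp
  · have h0 := congrFun hc 0
    simp only [ofTimeSpace_zero, Pi.smul_apply, coneMap_zero_apply, smul_eq_mul] at h0
    have hc0 : c = 0 := by simpa [hw0] using h0.symm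
    rw [hc0, zero_smul] at hc
    refine hX0 ?_
    have := congrArg (spatial n) hc
    simpa using this

/-- A form which satisfies the Gauss condition at a point of the cone, and whose pull-back to the
cone is positive on the sphere, is Lorentzian. -/
theorem isLorentzian_of_gauss_of_pos {G : Matrix (Fin (n + 1)) (Fin (n + 1)) ℝ} (hs : G.IsSymm)
    {w : Space n} (hw : w ≠ 0)
    (hG : ∀ ν, ∑ β, G ν β * coneMap n w β = ∑ β, minkowski n ν β * coneMap n w β)
    (hpos : ∀ X : Space n, inner ℝ w X = 0 → X ≠ 0 →
      0 < form G (fderiv ℝ (coneMap n) w X) (fderiv ℝ (coneMap n) w X)) : IsLorentzian G := by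
  have hn : ‖w‖ ≠ 0 := norm_ne_zero_iff.2 hw
  have hform := form_coneMap_of_gauss hs hG
  have hl : form G (coneMap n w) (coneMap n w) = 0 := by
    rw [hform, spatial_coneMap, real_inner_self_eq_norm_sq, coneMap_zero_apply]
    ring
  refine IsLorentzian.of_null hs (l := coneMap n w) (N := ofTimeSpace n (1, 0)) hl ?_
    fun Y hY hYc => ?_
  · rw [hform, spatial_ofTimeSpace, ofTimeSpace_zero]
    simpa using hn
  · set y := spatial n Y with hy
    -- With this `c`, a vector `Y` orthogonal to l = `coneMap n w` equals c l plus the image under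
    -- the differential of the angular vector y - cw; the null part c l does not affect G(Y,Y).
    set c := inner ℝ w y / ‖w‖ ^ 2 with hc
    have hcw : c * ‖w‖ ^ 2 = inner ℝ w y := div_mul_cancel₀ _ (pow_ne_zero 2 hn)
    have hY0 : Y 0 = c * ‖w‖ := by
      rw [hform] at hY
      refine mul_left_cancel₀ hn ?_
      linarith
    have hX : inner ℝ w (y - c • w) = (0 : ℝ) := by
      rw [inner_sub_right, inner_smul_right, real_inner_self_eq_norm_sq, hcw, sub_self]
    have hd : fderiv ℝ (coneMap n) w (y - c • w) = Y - c • coneMap n w := by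
      rw [fderiv_coneMap hw, theta, inner_smul_left, hX, mul_zero]
      funext μ
      refine Fin.cases ?_ (fun i => ?_) μ
      · simp [hY0]
      · simp [hy]
    have hX0 : y - c • w ≠ 0 := fun h => hYc c (by
      rw [h, map_zero] at hd
      exact sub_eq_zero.1 hd.symm)
    have h1 := hpos _ hX hX0
    rw [hd] at h1
    have hYl : form G Y (coneMap n w) = 0 := by rw [form_comm hs, hY]
    simp only [form_eq_toBilin', map_sub, map_smul, LinearMap.sub_apply, LinearMap.smul_apply,
      smul_eq_mul] at h1 hYl hl hY ⊢
    rw [hYl, hl, hY] at h1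
    linarith

/-- If `φ` has the required form, then it is the pull-back of a symmetric tensor field `g` which
satisfies the Gauss condition and is smooth on a cylinder. -/
theorem HasConeForm.exists_tensor {R : ENNReal} {φ : Space n → LinearMap.BilinForm ℝ (Space n)}
    (h : HasConeForm R φ) : ∃ g : Spacetime n → Matrix (Fin (n + 1)) (Fin (n + 1)) ℝ,
      (∀ μ ν, ContDiffOn ℝ ∞ (fun x => g x μ ν) (spatial n ⁻¹' ballR n R)) ∧
      (∀ x, (g x).IsSymm) ∧ g 0 = minkowski n ∧
      (∀ x ν, ∑ β, g x ν β * x β = ∑ β, minkowski n ν β * x β) ∧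
      ∀ w ∈ ballR n R, w ≠ 0 → ∀ X Y : Space n,
        φ w X Y = form (g (coneMap n w)) (fderiv ℝ (coneMap n) w X)
          (fderiv ℝ (coneMap n) w Y) := by
  obtain ⟨A, B, C, hA, hB, hC, hAs, hBs, hCs, hφ⟩ := h
  choose a ha haA using fun i j => (hA i j).exists_extension
  choose b hb hbB using fun i j k => (hB i j k).exists_extension
  choose c hc hcC using fun i j k l => (hC i j k l).exists_extension
  set T : Spacetime n → Fin (n + 1) → Fin (n + 1) → Fin (n + 1) → Fin (n + 1) → ℝ := fun x =>
    tensorOfCoeffs (fun i j => a i j x) (fun i j k => b i j k x) (fun i j k l => c i j k l x)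
    with hTdef
  have hT : ∀ μ α ν β, ContDiffOn ℝ ∞ (fun x => T x μ α ν β) (spatial n ⁻¹' ballR n R) := by
    intro μ α ν β
    cases μ using Fin.cases <;> cases α using Fin.cases <;> cases ν using Fin.cases <;>
      cases β using Fin.cases <;>
      simp only [hTdef, tensorOfCoeffs, Fin.cases_zero, Fin.cases_succ] <;>
      first
      | exact contDiffOn_const
      | exact ha _ _
      | exact (ha _ _).neg
      | exact hb _ _ _
      | exact (hb _ _ _).neg
      | exact hc _ _ _ _
  -- The components are extended independently, so `T` need not have the symmetries off the cone.
  -- Projecting restores them everywhere and changes nothing on the cone.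
  have hsym := fun x => hasCurvatureSymmetries_symmetrize (T x)
  have hconeT : ∀ w ∈ ballR n R, symmetrize (T (coneMap n w)) =
      tensorOfCoeffs (fun i j => A i j w) (fun i j k => B i j k w) (fun i j k l => C i j k l w) := by
    intro w hw
    have h1 : T (coneMap n w) = tensorOfCoeffs (fun i j => A i j w) (fun i j k => B i j k w)
        (fun i j k l => C i j k l w) := by
      simp only [hTdef, haA _ _ w hw, hbB _ _ _ w hw, hcC _ _ _ _ w hw]
    rw [h1]
    exact (hasCurvatureSymmetries_tensorOfCoeffs (hAs w hw) (hBs w hw) (hCs w hw)).symmetrize_eq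
  refine ⟨fun x => minkowski n + Matrix.of (quadraticTensor (symmetrize (T x)) x),
    fun μ ν => ?_, fun x => ?_, ?_, fun x ν => ?_, fun w hw hw0 X Y => ?_⟩
  · simp only [Matrix.add_apply, Matrix.of_apply, quadraticTensor, symmetrize]
    have hx : ∀ α : Fin (n + 1), ContDiffOn ℝ ∞ (fun x : Spacetime n => x α)
        (spatial n ⁻¹' ballR n R) := fun α => (contDiff_apply ℝ ℝ α).contDiffOn
    refine contDiffOn_const.add (ContDiffOn.sum fun α _ => ContDiffOn.sum fun β _ => ?_)
    refine ContDiffOn.mul (ContDiffOn.mul (ContDiffOn.div_const ?_ _) (hx α)) (hx β)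
    exact ((((((((hT _ _ _ _).sub (hT _ _ _ _)).sub (hT _ _ _ _)).add (hT _ _ _ _)).add
      (hT _ _ _ _)).sub (hT _ _ _ _)).sub (hT _ _ _ _)).add (hT _ _ _ _))
  · refine minkowski_isSymm.add (Matrix.IsSymm.ext fun μ ν => ?_)
    exact (hsym x).quadraticTensor_comm _ _ _
  · ext μ ν
    simp [quadraticTensor]
  · simp only [Matrix.add_apply, Matrix.of_apply, add_mul, Finset.sum_add_distrib]
    rw [(hsym x).sum_quadraticTensor_mul, add_zero]
  · set G := minkowski n + Matrix.of (quadraticTensor (symmetrize (T (coneMap n w))) (coneMap n w))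
      with hG
    set L : Space n →ₗ[ℝ] Spacetime n := (fderiv ℝ (coneMap n) w).toLinearMap with hLdef
    have hψ : φ w = (Matrix.toBilin' G).comp L L := by
      refine LinearMap.BilinForm.ext_basis (EuclideanSpace.basisFun (Fin n) ℝ).toBasis
        fun p q => ?_
      have hb : ∀ p, (EuclideanSpace.basisFun (Fin n) ℝ).toBasis p = basisVec p := fun p => by
        simp [basisVec]
      rw [hb, hb, LinearMap.BilinForm.comp_apply, ← form_eq_toBilin']
      have h1 := hφ w hw hw0 p q
      have h2 := (hsym (coneMap n w)).form_quadraticTensor_coneMap hw0 p q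
      have h3 := form_minkowski_fderiv_coneMap hw0 (basisVec p) (basisVec q)
      have h4 : form G (L (basisVec p)) (L (basisVec q)) = _ := form_add _ _ _ _
      rw [h4]
      simp only [hLdef, ContinuousLinearMap.coe_coe]
      rw [h3, h2, hconeT w hw]
      simp only [tensorOfCoeffs, Fin.cases_zero, Fin.cases_succ]
      linarith
    rw [hψ, LinearMap.BilinForm.comp_apply, ← form_eq_toBilin']
    rfl

/-- If `φ` has the required form on `r < R`, then it is the restriction of a metric in normal
coordinates on a neighbourhood of the vertex, which contains the points `r < R` of the cone as
soon as `φ` is positive definite there. -/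
theorem HasConeForm.exists_metric {R : ENNReal} (hR : 0 < R)
    {φ : Space n → LinearMap.BilinForm ℝ (Space n)} (h : HasConeForm R φ) :
    ∃ (U : Set (Spacetime n)) (g : Spacetime n → Matrix (Fin (n + 1)) (Fin (n + 1)) ℝ),
      IsOpen U ∧ StarConvex ℝ 0 U ∧ 0 ∈ U ∧ IsMetricOn U g ∧ IsNormalOn U g ∧
      (IsPosDefOn R φ → ∀ w ∈ ballR n R, coneMap n w ∈ U) ∧
      ∀ w ∈ ballR n R, w ≠ 0 → ∀ X Y : Space n,
        φ w X Y = form (g (coneMap n w)) (fderiv ℝ (coneMap n) w X)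
          (fderiv ℝ (coneMap n) w Y) := by
  obtain ⟨g, hgs, hsymm, hg0, hgauss, hφ⟩ := h.exists_tensor
  set V := spatial n ⁻¹' ballR n R with hV
  have hVo : IsOpen V := (isOpen_ballR R).preimage (spatial n).continuous
  have hVt : ∀ x ∈ V, ∀ t ∈ Icc (0 : ℝ) 1, t • x ∈ V := fun x hx t ht => by
    rw [hV, mem_preimage, map_smul]
    exact smul_mem_ballR hx ht.1 ht.2
  -- Requiring the Lorentzian signature on the whole segment to the origin makes `U` star-shaped;
  -- compactness of the segment keeps it open.
  set U := {x ∈ V | ∀ t ∈ Icc (0 : ℝ) 1, IsLorentzian (g (t • x))} with hU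
  have hUV : U ⊆ V := fun x hx => hx.1
  have hL0 : IsLorentzian (g 0) := by
    rw [hg0]
    exact isLorentzian_minkowski
  have hUo : IsOpen U := by
    rw [isOpen_iff_mem_nhds]
    rintro x ⟨hx, hxL⟩
    refine Filter.Eventually.and (hVo.mem_nhds hx) ?_
    refine isCompact_Icc.eventually_forall_of_forall_eventually fun t ht => ?_
    have h1 : ∀ᶠ y in 𝓝 (t • x), IsLorentzian (g y) :=
      IsLorentzian.eventually
        (fun μ ν => (hgs μ ν).continuousOn.continuousAt (hVo.mem_nhds (hVt x hx t ht)))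
        (Eventually.of_forall hsymm) (hxL t ht)
    have h2 : Continuous (fun p : Spacetime n × ℝ => p.2 • p.1) := continuous_snd.smul continuous_fst
    exact (h2.tendsto (x, t)).eventually h1
  have hstar : StarConvex ℝ 0 U := by
    rw [starConvex_zero_iff]
    intro x hx s hs0 hs1
    refine ⟨hVt x hx.1 s ⟨hs0, hs1⟩, fun t ht => ?_⟩
    rw [smul_smul]
    exact hx.2 _ ⟨mul_nonneg ht.1 hs0, mul_le_one₀ ht.2 hs0 hs1⟩
  have hmet : IsMetricOn U g := ⟨fun μ ν => (hgs μ ν).mono hUV, fun x hx => by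
    simpa using hx.2 1 ⟨zero_le_one, le_rfl⟩⟩
  refine ⟨U, g, hUo, hstar, ⟨?_, fun t _ => by rwa [smul_zero]⟩, hmet,
    isNormalOn_of_gauss hUo hmet hg0 fun x _ => hgauss x, fun hpd w hw => ⟨?_, fun t ht => ?_⟩, hφ⟩
  · rw [hV, mem_preimage, map_zero]
    exact zero_mem_ballR hR
  · rwa [hV, mem_preimage, spatial_coneMap]
  · rw [← coneMap_smul ht.1]
    have htw := smul_mem_ballR hw ht.1 ht.2
    by_cases h0 : t • w = 0
    · rwa [h0, coneMap_zero]
    · refine isLorentzian_of_gauss_of_pos (hsymm _) h0 (hgauss _) fun X hX hX0 => ?_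
      rw [← hφ _ htw h0]
      exact hpd _ htw h0 X hX hX0

/-- No positivity is needed: the domain of the metric is a neighbourhood of the origin, so it
contains the cone up to some positive radius. -/
theorem HasConeForm.exists_isConeRestriction {R : ENNReal} (hR : 0 < R)
    {φ : Space n → LinearMap.BilinForm ℝ (Space n)} (h : HasConeForm R φ) :
    ∃ R' : ENNReal, 0 < R' ∧ IsConeRestriction R' φ := by
  obtain ⟨U, g, hU, hstar, h0, hg, hN, -, hφ⟩ := h.exists_metric hR
  have h1 : coneMap n ⁻¹' U ∈ 𝓝 (0 : Space n) :=
    continuous_coneMap.continuousAt (hU.mem_nhds (by rwa [coneMap_zero]))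
  obtain ⟨ε, hε, hεU⟩ := EMetric.mem_nhds_iff.1 h1
  refine ⟨min R ε, lt_min hR hε, U, g, hU, hstar, fun w hw => ?_, hg, hN, fun w hw => ?_⟩
  · exact hεU (Metric.eball_subset_eball (min_le_right _ _) hw)
  · exact hφ w (Metric.eball_subset_eball (min_le_left _ _) hw)

end Main

end LightCone

theorem mainTheorem3 (n : ℕ)
    (φ : LightCone.Space n → LinearMap.BilinForm ℝ (LightCone.Space n))
    (hφ : LightCone.IsAngular φ) :
    ((∃ R : ENNReal, 0 < R ∧ LightCone.IsConeRestriction R φ) ↔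
      ∃ R : ENNReal, 0 < R ∧ LightCone.HasConeForm R φ) ∧
    ∀ R : ENNReal, 0 < R →
      (LightCone.IsConeRestriction R φ ↔
        LightCone.IsPosDefOn R φ ∧ LightCone.HasConeForm R φ) := by
  refine ⟨⟨fun ⟨R, hR, h⟩ => ⟨R, hR, LightCone.hasConeForm_of_metric hR h⟩,
    fun ⟨R, hR, h⟩ => h.exists_isConeRestriction hR⟩, fun R hR => ⟨fun h =>
      ⟨LightCone.isPosDefOn_of_metric h, LightCone.hasConeForm_of_metric hR h⟩, fun ⟨hp, h⟩ => ?_⟩⟩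
  obtain ⟨U, g, hU, hstar, -, hg, hN, hcone, hform⟩ := h.exists_metric hR
  exact ⟨U, g, hU, hstar, hcone hp, hg, hN, hform⟩
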